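/- Let $d\ge 1$, $\sigma>0$, $\alpha\in(0,1)$, and let $\Omega\subset\mathbb R^d$ be a bounded domain (non-empty, open, connected) whose boundary is of class $C^{2,\alpha}$, with outer unit normal $\nu$. Let $h:\Omega\times(0,\infty)\to\mathbb R$ satisfy: - for every $x\in\Omega$ the function $h(x,\cdot)$ is increasing (not necessarily strictly); - $h\in C^2(\Omega\times(0,\infty))\cap C^1(\overline\Omega\times(0,\infty))$; - there are continuous functions $g,f:(0,\infty)\to[0,\infty)$ with $\sup_{x\in\Omega}|h(x,s)|\le g(s)$ and $\sup_{x\in\Omega}|\nabla_x h(x,s)|\le f(s)$ for every $s\in(0,\infty)$. Here $C^1(\overline\Omega)$ (and likewise $C^1(\overline\Omega\times(0,\infty))$) means that the function and its first derivatives extend continuously from the open set up to the boundary; values and fluxes at boundary points are the limits from inside. Then there exists a unique function $m:\Omega\to(0,\infty)$ such that $$m\in C^2(\Omega)\cap C^1(\overline\Omega),$$ $$-\tfrac{\sigma^2}{2}\Delta m-\nabla\cdot\big(m\,\nabla[h(x,m(x))]\big)=0\quad\text{in }\Omega,$$ $$-\tfrac{\sigma^2}{2}\nabla m\cdot\nu-m\,\nabla[h(x,m(x))]\cdot\nu=0\quad\text{on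 }\partial\Omega,$$ $$\int_\Omega m\,dx=1.$$ Moreover, there is a $Z\in(0,\infty)$ such that this $m$ satisfies $$m(x)=\frac1Z\,e^{-\frac{2}{\sigma^2}h(x,m(x))}\quad\text{for all }x\in\Omega,$$ and the pair $(m,Z)$ is unique: if $Z'\in(0,\infty)$ and $m':\Omega\to(0,\infty)$ satisfy $m'(x)=\frac1{Z'}e^{-\frac{2}{\sigma^2}h(x,m'(x))}$ for all $x\in\Omega$ and $\int_\Omega m'\,dx=1$, then $Z'=Z$ and $m'=m$. -/

import Mathlib

open Set Filter Topology MeasureTheory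

/-- `Ω` has boundary of class `C^{2,α}`: near each boundary point `x₀` there are a unit vector `e`
and a function `γ` on the hyperplane `eᗮ`, of class `C²` with `α`-Hölder second derivative, such
that in a ball around `x₀` the set `Ω` consists of the points lying strictly above the graph of `γ`
in the direction `e`. -/
def HasC2HolderBoundary {d : ℕ} (α : NNReal) (Ω : Set (EuclideanSpace ℝ (Fin d))) : Prop :=
  ∀ x₀ ∈ frontier Ω, ∃ (r : ℝ) (e : EuclideanSpace ℝ (Fin d))
      (γ : (Submodule.span ℝ {e})ᗮ → ℝ) (C : NNReal),
    0 < r ∧ ‖e‖ = 1 ∧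
    ContDiffOn ℝ 2 γ
      (Metric.ball ((Submodule.span ℝ {e})ᗮ.orthogonalProjectionOnto x₀) r) ∧
    HolderOnWith C α (iteratedFDeriv ℝ 2 γ)
      (Metric.ball ((Submodule.span ℝ {e})ᗮ.orthogonalProjectionOnto x₀) r) ∧
    ∀ x ∈ Metric.ball x₀ r,
      (x ∈ Ω ↔ γ ((Submodule.span ℝ {e})ᗮ.orthogonalProjectionOnto x) < inner ℝ x e)

/-- `ν` is the outer unit normal to `Ω` at the boundary point `x`: every direction in the open
half-space `⟪v, ν⟫ < 0` points into `Ω`, and every direction in the opposite open half-space points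
out of `closure Ω`. There is at most one such `ν`, and on a set with `C¹` boundary there is one at
every boundary point. -/
def IsOuterUnitNormal {d : ℕ} (Ω : Set (EuclideanSpace ℝ (Fin d)))
    (x ν : EuclideanSpace ℝ (Fin d)) : Prop :=
  ‖ν‖ = 1 ∧ ∀ v : EuclideanSpace ℝ (Fin d),
    (inner ℝ v ν < 0 → ∀ᶠ t : ℝ in 𝓝[>] 0, x + t • v ∈ Ω) ∧
    (0 < inner ℝ v ν → ∀ᶠ t : ℝ in 𝓝[>] 0, x + t • v ∉ closure Ω)

/-- `f ∈ C¹(S)`, for an open set `D` and `D ⊆ S ⊆ closure D`: `f` is `C¹` in `D`, and both `f` and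
its derivative have limits, along `D`, at every point of `S` (equivalently, they extend
continuously from `D` to `S`). Only the values of `f` in `D` matter. -/
def IsC1UpTo {F : Type*} [NormedAddCommGroup F] [NormedSpace ℝ F] (D S : Set F) (f : F → ℝ) :
    Prop :=
  ContDiffOn ℝ 1 f D ∧
  ∀ p ∈ S, (∃ l : ℝ, Tendsto f (𝓝[D] p) (𝓝 l)) ∧
    ∃ L : F →L[ℝ] ℝ, Tendsto (fderiv ℝ f) (𝓝[D] p) (𝓝 L)

/-- The divergence `∑ i, ∂ᵢ Vᵢ` of a vector field. -/
noncomputable def divergence {d : ℕ} (V : EuclideanSpace ℝ (Fin d) → EuclideanSpace ℝ (Fin d))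
    (x : EuclideanSpace ℝ (Fin d)) : ℝ :=
  ∑ i, (fderiv ℝ V x (EuclideanSpace.single i 1)) i

/-- The vector field `m ∇[h(x, m(x))]`; the gradient is that of the composite `x ↦ h x (m x)`. -/
noncomputable def brsDrift {d : ℕ} (h : EuclideanSpace ℝ (Fin d) → ℝ → ℝ)
    (m : EuclideanSpace ℝ (Fin d) → ℝ) (x : EuclideanSpace ℝ (Fin d)) :
    EuclideanSpace ℝ (Fin d) :=
  m x • gradient (fun y => h y (m y)) x

/-- `m : Ω → (0,∞)` is a classical solution of the stationary BRS boundary value problem.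
Only the values of `m` in `Ω` matter. As everything in the boundary condition is only given in `Ω`
and extended continuously, the normal flux at a boundary point is the limit of the flux from
inside `Ω`. -/
structure IsStationaryBRS {d : ℕ} (σ : ℝ) (Ω : Set (EuclideanSpace ℝ (Fin d)))
    (h : EuclideanSpace ℝ (Fin d) → ℝ → ℝ) (m : EuclideanSpace ℝ (Fin d) → ℝ) : Prop where
  pos : ∀ x ∈ Ω, 0 < m x
  contDiffOn : ContDiffOn ℝ 2 m Ω
  isC1UpTo : IsC1UpTo Ω (closure Ω) m
  pde : ∀ x ∈ Ω, -(σ ^ 2 / 2) * Laplacian.laplacian m x - divergence (brsDrift h m) x = 0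
  noFlux : ∀ x ∈ frontier Ω, ∀ ν, IsOuterUnitNormal Ω x ν →
    Tendsto (fun y => -(σ ^ 2 / 2) * inner ℝ (gradient m y) ν - inner ℝ (brsDrift h m y) ν)
      (𝓝[Ω] x) (𝓝 0)
  integral_eq_one : ∫ x in Ω, m x = 1

/-! Put `a = σ²/2` and `u = a log m + h(x, m)`. Since `m ∇ log m = ∇ m`, the flux is `-m ∇ u`, so
the boundary value problem says `∇ · (m ∇ u) = 0` without normal flux. Everything rests on its
equivalence with `u` being constant.

If `u` is constant, the flux vanishes identically. Conversely, dividing by `m` gives `Δ u + ⟪∇ m /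
m, ∇ u⟫ = 0`. If the supremum of `u` is attained inside, the strong maximum principle makes `u`
constant. If it is only reached as a limit at a boundary point, Hopf's lemma gives `u` a strictly
negative slope along the inner normal there, against the zero flux (`exists_eqOn_const_of_noFlux`).
A solution could tend to `0` at the boundary, where the drift `∇ m / m` is not controlled; but `h(x,
m) ≤ h(x, 1)` for `m ≤ 1`, so `u` tends to `-∞` there and such points cannot carry the supremum.

There remains a scalar equation for each `x`: `s ↦ a log s + h(x, s)` is a strictly increasing
bijection from `(0, ∞)` to `ℝ`, so each level `c` has exactly one solution `S c`. The implicit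
function theorem gives its regularity, because the `s`-derivative is at least `a / s > 0`. Its mass
is continuous and strictly increasing in `c` and passes through `1`, which fixes `c`, and with it `Z
= exp(-c / a)`. -/

/-! ### Second-order condition at a local maximum. -/

theorem hasDerivAt_comp_line {E : Type*} [NormedAddCommGroup E] [NormedSpace ℝ E]
    {f : E → ℝ} {x v : E} {t : ℝ} (hf : DifferentiableAt ℝ f (x + t • v)) :
    HasDerivAt (fun s : ℝ => f (x + s • v)) (fderiv ℝ f (x + t • v) v) t := by
  have h1 : HasDerivAt (fun s : ℝ => x + s • v) v t := by
    simpa using ((hasDerivAt_id t).smul_const v).const_add x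
  exact hf.hasFDerivAt.comp_hasDerivAt t h1

theorem tendsto_add_smul_nhds {E : Type*} [NormedAddCommGroup E] [NormedSpace ℝ E] (x v : E) :
    Tendsto (fun s : ℝ => x + s • v) (𝓝 0) (𝓝 x) := by
  have : Continuous fun s : ℝ => x + s • v := by fun_prop
  simpa using this.tendsto 0

theorem deriv_deriv_comp_line {E : Type*} [NormedAddCommGroup E] [NormedSpace ℝ E]
    {f : E → ℝ} {x : E} (hf : ContDiffAt ℝ 2 f x) (v : E) :
    deriv (deriv fun s : ℝ => f (x + s • v)) 0 = iteratedFDeriv ℝ 2 f x ![v, v] := by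
  have hev : ∀ᶠ y in 𝓝 x, DifferentiableAt ℝ f y :=
    (hf.eventually (by simp)).mono fun y hy => hy.differentiableAt (by simp)
  have h1 : (deriv fun s : ℝ => f (x + s • v)) =ᶠ[𝓝 0] fun s => fderiv ℝ f (x + s • v) v := by
    filter_upwards [(tendsto_add_smul_nhds x v).eventually hev] with s hs
    exact (hasDerivAt_comp_line hs).deriv
  have hd : DifferentiableAt ℝ (fderiv ℝ f) x :=
    (hf.fderiv_right (m := 1) (by norm_num)).differentiableAt (by simp)
  have h2 : HasDerivAt (fun s : ℝ => fderiv ℝ f (x + s • v)) (fderiv ℝ (fderiv ℝ f) x v) 0 := by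
    have h3 : HasDerivAt (fun s : ℝ => x + s • v) v 0 := by
      simpa using ((hasDerivAt_id (0 : ℝ)).smul_const v).const_add x
    have hd' : HasFDerivAt (fderiv ℝ f) (fderiv ℝ (fderiv ℝ f) x) (x + (0 : ℝ) • v) := by
      simpa using hd.hasFDerivAt
    exact hd'.comp_hasDerivAt 0 h3
  have h4 : HasDerivAt (fun s : ℝ => fderiv ℝ f (x + s • v) v)
      (fderiv ℝ (fderiv ℝ f) x v v) 0 := by
    simpa using h2.clm_apply (hasDerivAt_const (0 : ℝ) v)
  rw [h1.deriv_eq, h4.deriv, iteratedFDeriv_two_apply]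
  simp

/-- Were it positive, the second derivative test would make the point a local minimum along the line
as well; the restriction would be locally constant and its second derivative zero. -/
theorem iteratedFDeriv_two_nonpos_of_isLocalMax {E : Type*} [NormedAddCommGroup E]
    [NormedSpace ℝ E] {f : E → ℝ} {x : E} (hf : ContDiffAt ℝ 2 f x) (hmax : IsLocalMax f x)
    (v : E) : iteratedFDeriv ℝ 2 f x ![v, v] ≤ 0 := by
  by_contra! hpos
  rw [← deriv_deriv_comp_line hf] at hpos
  set g : ℝ → ℝ := fun s => f (x + s • v)
  have hdiff : DifferentiableAt ℝ f (x + (0 : ℝ) • v) := by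
    simpa using hf.differentiableAt (by simp)
  have hg : HasDerivAt g (fderiv ℝ f (x + (0 : ℝ) • v) v) 0 := hasDerivAt_comp_line hdiff
  have hgmax : IsLocalMax g 0 := by
    have := (tendsto_add_smul_nhds x v).eventually hmax
    filter_upwards [this] with s hs
    simpa [g] using hs
  have hgmin : IsLocalMin g 0 :=
    isLocalMin_of_deriv_deriv_pos hpos hgmax.deriv_eq_zero hg.continuousAt
  have hconst : g =ᶠ[𝓝 0] fun _ => g 0 := by
    filter_upwards [hgmax, hgmin] with s h1 h2 using le_antisymm h1 h2
  rw [hconst.deriv.deriv_eq] at hpos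
  simp at hpos

/-! ### Divergence, Laplacian and the Gaussian barrier. -/

section

variable {d : ℕ}

theorem laplacian_nonpos_of_isLocalMax {f : EuclideanSpace ℝ (Fin d) → ℝ}
    {x : EuclideanSpace ℝ (Fin d)} (hf : ContDiffAt ℝ 2 f x) (hmax : IsLocalMax f x) :
    Laplacian.laplacian f x ≤ 0 := by
  rw [InnerProductSpace.laplacian_eq_iteratedFDeriv_orthonormalBasis f
    (EuclideanSpace.basisFun (Fin d) ℝ)]
  exact Finset.sum_nonpos fun i _ => iteratedFDeriv_two_nonpos_of_isLocalMax hf hmax _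

theorem inner_gradient_eq_fderiv {E : Type*} [NormedAddCommGroup E] [InnerProductSpace ℝ E]
    [CompleteSpace E] (f : E → ℝ) (x v : E) : inner ℝ (gradient f x) v = fderiv ℝ f x v :=
  inner_gradient_left

theorem differentiableAt_gradient {E : Type*} [NormedAddCommGroup E] [InnerProductSpace ℝ E]
    [CompleteSpace E] {f : E → ℝ} {x : E} (hf : ContDiffAt ℝ 2 f x) :
    DifferentiableAt ℝ (gradient f) x := by
  have hd : DifferentiableAt ℝ (fderiv ℝ f) x :=
    (hf.fderiv_right (m := 1) (by norm_num)).differentiableAt (by simp)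
  exact ((InnerProductSpace.toDual ℝ E).symm.toContinuousLinearEquiv.differentiableAt).comp x hd

theorem divergence_gradient {f : EuclideanSpace ℝ (Fin d) → ℝ}
    {x : EuclideanSpace ℝ (Fin d)} (hf : ContDiffAt ℝ 2 f x) :
    divergence (gradient f) x = Laplacian.laplacian f x := by
  rw [InnerProductSpace.laplacian_eq_iteratedFDeriv_orthonormalBasis f
    (EuclideanSpace.basisFun (Fin d) ℝ)]
  refine Finset.sum_congr rfl fun i _ => ?_
  have hd : DifferentiableAt ℝ (fderiv ℝ f) x :=
    (hf.fderiv_right (m := 1) (by norm_num)).differentiableAt (by simp)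
  have h1 : HasFDerivAt (fun y => inner ℝ (gradient f y) (EuclideanSpace.single i (1 : ℝ)))
      ((innerSL ℝ (EuclideanSpace.single i (1 : ℝ))).comp (fderiv ℝ (gradient f) x)) x := by
    have := (innerSL ℝ (EuclideanSpace.single i (1 : ℝ))).hasFDerivAt.comp x
      (differentiableAt_gradient hf).hasFDerivAt
    refine this.congr_of_eventuallyEq (Eventually.of_forall fun y => ?_)
    simp [real_inner_comm]
  have h2 : HasFDerivAt (fun y => inner ℝ (gradient f y) (EuclideanSpace.single i (1 : ℝ)))
      ((fderiv ℝ (fderiv ℝ f) x).flip (EuclideanSpace.single i (1 : ℝ))) x := by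
    simp only [inner_gradient_eq_fderiv]
    simpa using hd.hasFDerivAt.clm_apply (hasFDerivAt_const (EuclideanSpace.single i (1 : ℝ)) x)
  have h3 := congrArg (fun L => L (EuclideanSpace.single i (1 : ℝ))) (h1.unique h2)
  rw [iteratedFDeriv_two_apply]
  simpa [EuclideanSpace.inner_single_left] using h3

theorem divergence_congr {V W : EuclideanSpace ℝ (Fin d) → EuclideanSpace ℝ (Fin d)}
    {x : EuclideanSpace ℝ (Fin d)} (h : V =ᶠ[𝓝 x] W) : divergence V x = divergence W x := by
  simp [divergence, h.fderiv_eq]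

theorem divergence_smul {φ : EuclideanSpace ℝ (Fin d) → ℝ}
    {V : EuclideanSpace ℝ (Fin d) → EuclideanSpace ℝ (Fin d)} {x : EuclideanSpace ℝ (Fin d)}
    (hφ : DifferentiableAt ℝ φ x) (hV : DifferentiableAt ℝ V x) :
    divergence (fun y => φ y • V y) x = inner ℝ (gradient φ x) (V x) + φ x * divergence V x := by
  have hsum : V x = ∑ i, V x i • EuclideanSpace.single i (1 : ℝ) := by
    simpa using ((EuclideanSpace.basisFun (Fin d) ℝ).sum_repr (V x)).symm
  rw [inner_gradient_eq_fderiv]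
  conv_rhs => rw [hsum]
  simp only [divergence, fderiv_fun_smul hφ hV, map_sum, map_smul, Finset.mul_sum,
    ← Finset.sum_add_distrib]
  refine Finset.sum_congr rfl fun i _ => ?_
  simp
  ring

theorem divergence_const_smul (c : ℝ)
    {V : EuclideanSpace ℝ (Fin d) → EuclideanSpace ℝ (Fin d)} {x : EuclideanSpace ℝ (Fin d)}
    (hV : DifferentiableAt ℝ V x) :
    divergence (fun y => c • V y) x = c * divergence V x := by
  simp [divergence, fderiv_fun_const_smul hV, Finset.mul_sum]

theorem divergence_add
    {V W : EuclideanSpace ℝ (Fin d) → EuclideanSpace ℝ (Fin d)} {x : EuclideanSpace ℝ (Fin d)}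
    (hV : DifferentiableAt ℝ V x) (hW : DifferentiableAt ℝ W x) :
    divergence (fun y => V y + W y) x = divergence V x + divergence W x := by
  simp [divergence, fderiv_fun_add hV hW, Finset.sum_add_distrib]

theorem divergence_sub_const (y x : EuclideanSpace ℝ (Fin d)) :
    divergence (fun z => z - y) x = d := by
  simp [divergence, fderiv_sub_const]

theorem hasGradientAt_exp_neg_normSq {E : Type*} [NormedAddCommGroup E] [InnerProductSpace ℝ E]
    [CompleteSpace E] (k : ℝ) (y x : E) :
    HasGradientAt (fun z => Real.exp (-k * ‖z - y‖ ^ 2))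
      ((-2 * k * Real.exp (-k * ‖x - y‖ ^ 2)) • (x - y)) x := by
  rw [hasGradientAt_iff_hasFDerivAt]
  have h1 : HasFDerivAt (fun z : E => z - y) (ContinuousLinearMap.id ℝ E) x :=
    (hasFDerivAt_id x).sub_const y
  have h2 := ((h1.norm_sq).const_mul (-k)).exp
  refine h2.congr_fderiv ?_
  ext v
  simp
  ring

theorem contDiff_exp_neg_normSq {E : Type*} [NormedAddCommGroup E] [InnerProductSpace ℝ E]
    (k : ℝ) (y : E) : ContDiff ℝ 2 (fun z => Real.exp (-k * ‖z - y‖ ^ 2)) :=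
  (contDiff_const.mul ((contDiff_id.sub contDiff_const).norm_sq ℝ)).exp

/-- For large `k` the `k²` term dominates away from `y`, which makes this Gaussian a strict
subsolution on an annulus in Hopf's lemma. -/
theorem laplacian_exp_neg_normSq (k : ℝ) (y x : EuclideanSpace ℝ (Fin d)) :
    Laplacian.laplacian (fun z => Real.exp (-k * ‖z - y‖ ^ 2)) x
      = (4 * k ^ 2 * ‖x - y‖ ^ 2 - 2 * k * d) * Real.exp (-k * ‖x - y‖ ^ 2) := by
  rw [← divergence_gradient (contDiff_exp_neg_normSq k y).contDiffAt]
  have h0 : gradient (fun z => Real.exp (-k * ‖z - y‖ ^ 2))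
      = fun z => Real.exp (-k * ‖z - y‖ ^ 2) • ((-2 * k) • (z - y)) := by
    funext z
    rw [(hasGradientAt_exp_neg_normSq k y z).gradient, smul_smul, mul_comm (-2 * k)]
  rw [h0, divergence_smul (hasGradientAt_exp_neg_normSq k y x).differentiableAt (by fun_prop),
    divergence_const_smul _ (by fun_prop), divergence_sub_const,
    (hasGradientAt_exp_neg_normSq k y x).gradient, inner_smul_right, real_inner_smul_left,
    real_inner_self_eq_norm_sq]
  simp
  ring

/-! ### Hopf's lemma and the strong maximum principle. -/

/-- Boundary point lemma: a solution of `Δ u + ⟪b, ∇ u⟫ = 0` with bounded `b`, which is less than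
`M` in a closed ball except at one point `x₀` of its boundary, where it tends to `M`, grows at
least linearly along the inner normal at `x₀`. -/
theorem hopf_boundary_point {u : EuclideanSpace ℝ (Fin d) → ℝ}
    {b : EuclideanSpace ℝ (Fin d) → EuclideanSpace ℝ (Fin d)}
    {y x₀ : EuclideanSpace ℝ (Fin d)} {R M B : ℝ} (hR : 0 < R) (hx₀ : ‖x₀ - y‖ = R)
    (hu : ∀ x ∈ Metric.closedBall y R \ {x₀}, ContDiffAt ℝ 2 u x)
    (hlt : ∀ x ∈ Metric.closedBall y R \ {x₀}, u x < M)
    (hlim : Tendsto u (𝓝[Metric.closedBall y R \ {x₀}] x₀) (𝓝 M))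
    (hL : ∀ x ∈ Metric.closedBall y R \ {x₀},
      Laplacian.laplacian u x + inner ℝ (b x) (gradient u x) = 0)
    (hb : ∀ x ∈ Metric.closedBall y R \ {x₀}, ‖b x‖ ≤ B) :
    ∃ c > 0, ∀ t ∈ Ioo (0 : ℝ) (1 / 2), u (x₀ + t • (y - x₀)) ≤ M - c * t := by
  have hB : 0 ≤ B := by
    refine (norm_nonneg _).trans (hb y ⟨Metric.mem_closedBall_self hR.le, ?_⟩)
    rintro rfl
    simp at hx₀
    linarith
  -- Chosen so that `2 k (R/2)² = d + B R + 1`, which exceeds `d + ⟪b, x - y⟫` on the annulus.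
  set k : ℝ := 2 * (d + B * R + 1) / R ^ 2 with hk
  have hkpos : 0 < k := by positivity
  have hkR : k * R ^ 2 = 2 * (d + B * R + 1) := by rw [hk]; field_simp
  set w : EuclideanSpace ℝ (Fin d) → ℝ := fun z => Real.exp (-k * ‖z - y‖ ^ 2) with hw
  set wR : ℝ := Real.exp (-k * R ^ 2) with hwR
  -- the operator applied to the barrier
  have hLw : ∀ x ∈ Metric.closedBall y R \ {x₀}, R / 2 < ‖x - y‖ →
      0 < Laplacian.laplacian w x + inner ℝ (b x) (gradient w x) := by
    intro x hx hxr
    have hxR : ‖x - y‖ ≤ R := by simpa [dist_eq_norm] using hx.1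
    have h1 : inner ℝ (b x) (x - y) ≤ B * R :=
      (real_inner_le_norm _ _).trans (mul_le_mul (hb x hx) hxR (norm_nonneg _) hB)
    have h2 : (R / 2) ^ 2 ≤ ‖x - y‖ ^ 2 := by gcongr
    simp only [hw]
    rw [laplacian_exp_neg_normSq, (hasGradientAt_exp_neg_normSq k y x).gradient,
      inner_smul_right]
    have h3 : 0 < 2 * k * (2 * k * ‖x - y‖ ^ 2 - d - inner ℝ (b x) (x - y)) := by
      have : k * (R / 2) ^ 2 ≤ k * ‖x - y‖ ^ 2 := by gcongr
      have : 0 < 2 * k * ‖x - y‖ ^ 2 - d - inner ℝ (b x) (x - y) := by nlinarith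
      positivity
    have := mul_pos h3 (Real.exp_pos (-k * ‖x - y‖ ^ 2))
    linarith
  -- `u` on the inner sphere
  obtain ⟨ε, hε, hεu⟩ : ∃ ε > 0, ∀ x, ‖x - y‖ = R / 2 → u x + ε * (w x - wR) ≤ M := by
    have hsub : Metric.sphere y (R / 2) ⊆ Metric.closedBall y R \ {x₀} := by
      intro x hx
      have hx' : ‖x - y‖ = R / 2 := by simpa [dist_eq_norm] using hx
      refine ⟨by simp [dist_eq_norm, hx']; linarith, ?_⟩
      rintro rfl
      linarith
    rcases (Metric.sphere y (R / 2)).eq_empty_or_nonempty with hemp | hne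
    · refine ⟨1, one_pos, fun x hx => ?_⟩
      have : x ∈ Metric.sphere y (R / 2) := by simpa [dist_eq_norm] using hx
      simp [hemp] at this
    · obtain ⟨z, hz, hzmax⟩ := (isCompact_sphere y (R / 2)).exists_isMaxOn hne
        (fun x hx => (hu x (hsub hx)).continuousAt.continuousWithinAt)
      have hzM := hlt z (hsub hz)
      -- The gap below `M` on the inner sphere can serve as `ε` because `w - wR < 1`.
      refine ⟨M - u z, by linarith, fun x hx => ?_⟩
      have hx' : x ∈ Metric.sphere y (R / 2) := by simpa [dist_eq_norm] using hx
      have h1 : u x ≤ u z := hzmax hx'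
      have h2 : w x ≤ 1 := Real.exp_le_one_iff.2 (by nlinarith [sq_nonneg ‖x - y‖])
      have h3 : 0 < wR := Real.exp_pos _
      nlinarith
  -- Giving `u` the value `M` at `x₀` makes it continuous on the closed annulus, so the perturbed
  -- function has a maximum there.
  set U : EuclideanSpace ℝ (Fin d) → ℝ := Function.update u x₀ M with hU
  have hUne : ∀ x, x ≠ x₀ → U x = u x := fun x hx => Function.update_of_ne hx _ _
  have hUx₀ : U x₀ = M := Function.update_self _ _ _
  set A : Set (EuclideanSpace ℝ (Fin d)) := {x | R / 2 ≤ ‖x - y‖ ∧ ‖x - y‖ ≤ R} with hA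
  have hAcl : IsClosed A := by
    have h1 : IsClosed {x : EuclideanSpace ℝ (Fin d) | R / 2 ≤ ‖x - y‖} :=
      isClosed_le continuous_const (by fun_prop)
    have h2 : IsClosed {x : EuclideanSpace ℝ (Fin d) | ‖x - y‖ ≤ R} :=
      isClosed_le (by fun_prop) continuous_const
    exact h1.inter h2
  have hAsub : A ⊆ Metric.closedBall y R := fun x hx => by simpa [dist_eq_norm] using hx.2
  have hAcomp : IsCompact A := (isCompact_closedBall y R).of_isClosed_subset hAcl hAsub
  have hx₀A : x₀ ∈ A := ⟨by linarith, hx₀.le⟩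
  have hUcont : ContinuousOn U (Metric.closedBall y R) := by
    intro x hx
    by_cases hxx : x = x₀
    · rw [hxx]
      exact continuousWithinAt_update_same.2 hlim
    · have h1 : U =ᶠ[𝓝 x] u := by
        filter_upwards [isOpen_ne.mem_nhds hxx] with z hz using hUne z hz
      exact ((hu x ⟨hx, hxx⟩).continuousAt.congr h1.symm).continuousWithinAt
  have hwcd : ContDiff ℝ 2 w := contDiff_exp_neg_normSq k y
  obtain ⟨z, hzA, hzmax⟩ := hAcomp.exists_isMaxOn ⟨x₀, hx₀A⟩
    (f := fun x => U x + ε * (w x - wR))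
    ((hUcont.mono hAsub).add
      (continuousOn_const.mul (hwcd.continuous.continuousOn.sub continuousOn_const)))
  -- A value above `M` is excluded at `x₀` and on the outer sphere, where `w = wR`, and on the inner
  -- sphere by the choice of `ε`. At an interior maximum the gradient vanishes and the Laplacian is
  -- nonpositive, whereas the operator applied to `u + ε w` is positive.
  have hzle : U z + ε * (w z - wR) ≤ M := by
    by_contra! hgt
    have hzx₀ : z ≠ x₀ := by
      rintro rfl
      rw [hUx₀] at hgt
      simp only [hw, hx₀, hwR] at hgt
      simp at hgt
    have hzB : z ∈ Metric.closedBall y R \ {x₀} := ⟨hAsub hzA, hzx₀⟩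
    rw [hUne z hzx₀] at hgt
    have h1 : R / 2 < ‖z - y‖ := by
      refine lt_of_le_of_ne hzA.1 fun h => ?_
      linarith [hεu z h.symm]
    have h2 : ‖z - y‖ < R := by
      refine lt_of_le_of_ne hzA.2 fun h => ?_
      have := hlt z hzB
      simp only [hw, h, hwR] at hgt
      simp at hgt
      linarith
    set v : EuclideanSpace ℝ (Fin d) → ℝ := u + ε • w with hv
    have hvmax : IsLocalMax v z := by
      have hn : ∀ᶠ x in 𝓝 z, x ∈ A ∧ x ≠ x₀ := by
        have c1 : ∀ᶠ x in 𝓝 z, R / 2 < ‖x - y‖ :=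
          (isOpen_lt continuous_const (by fun_prop)).mem_nhds h1
        have c2 : ∀ᶠ x in 𝓝 z, ‖x - y‖ < R :=
          (isOpen_lt (by fun_prop) continuous_const).mem_nhds h2
        filter_upwards [c1, c2, isOpen_ne.mem_nhds hzx₀] with x a1 a2 a3
        exact ⟨⟨a1.le, a2.le⟩, a3⟩
      filter_upwards [hn] with x hx
      have := hzmax hx.1
      simp only [mem_ofPred_eq, hUne x hx.2, hUne z hzx₀] at this
      simp only [hv, Pi.add_apply, Pi.smul_apply, smul_eq_mul]
      linarith
    have hu2 := hu z hzB
    have hw2 : ContDiffAt ℝ 2 (ε • w) z := (hwcd.const_smul ε).contDiffAt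
    have hv2 : ContDiffAt ℝ 2 v z := hu2.add hw2
    have h3 := laplacian_nonpos_of_isLocalMax hv2 hvmax
    rw [hv, hu2.laplacian_add hw2, InnerProductSpace.laplacian_smul ε hwcd.contDiffAt,
      smul_eq_mul] at h3
    have h4 : fderiv ℝ v z = 0 := hvmax.fderiv_eq_zero
    rw [hv, fderiv_add (hu2.differentiableAt (by simp)) (hw2.differentiableAt (by simp)),
      fderiv_const_smul (hwcd.differentiable (by simp) z)] at h4
    have h5 := congrArg (fun L => L (b z)) h4
    simp only [add_apply, smul_apply, smul_eq_mul,
      zero_apply, ← inner_gradient_eq_fderiv] at h5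
    have h6 := hL z hzB
    have h7 := mul_pos hε (hLw z hzB h1)
    rw [real_inner_comm] at h6
    rw [real_inner_comm] at h7
    linarith
  -- Along the normal `w = wR exp(k R² (2t - t²))`, which is at least `wR (1 + k R² t)`.
  refine ⟨ε * (wR * (k * R ^ 2)), by positivity, fun t ht => ?_⟩
  have hdist : ‖x₀ + t • (y - x₀) - y‖ = (1 - t) * R := by
    have : x₀ + t • (y - x₀) - y = (1 - t) • (x₀ - y) := by module
    rw [this, norm_smul, hx₀, Real.norm_of_nonneg (by linarith [ht.2])]
  have hmem : x₀ + t • (y - x₀) ∈ A := by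
    simp only [hA, mem_ofPred_eq, hdist]
    constructor <;> nlinarith [ht.1, ht.2]
  have hne : x₀ + t • (y - x₀) ≠ x₀ := by
    intro h
    rw [h, hx₀] at hdist
    nlinarith [ht.1]
  have h1 := (hzmax hmem).trans hzle
  simp only [hUne _ hne] at h1
  have h2 : wR * (k * R ^ 2 * t) ≤ w (x₀ + t • (y - x₀)) - wR := by
    have e1 : w (x₀ + t • (y - x₀)) = wR * Real.exp (k * R ^ 2 * (2 * t - t ^ 2)) := by
      simp only [hw, hdist, hwR]
      rw [← Real.exp_add]
      congr 1
      ring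
    have e2 := Real.add_one_le_exp (k * R ^ 2 * (2 * t - t ^ 2))
    have e3 : k * R ^ 2 * t ≤ k * R ^ 2 * (2 * t - t ^ 2) := by
      gcongr
      nlinarith [ht.1, ht.2]
    rw [e1]
    have : 0 < wR := Real.exp_pos _
    nlinarith
  nlinarith

end

theorem le_neg_of_hasDerivWithinAt_of_le {g : ℝ → ℝ} {M g' c : ℝ}
    (hg : HasDerivWithinAt g g' (Ici 0) 0) (h0 : g 0 = M)
    (hle : ∀ᶠ t in 𝓝[>] (0 : ℝ), g t ≤ M - c * t) : g' ≤ -c := by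
  have h1 := hasDerivWithinAt_iff_tendsto_slope.1 hg
  rw [Ici_sdiff_left] at h1
  refine le_of_tendsto h1 ?_
  filter_upwards [hle, self_mem_nhdsWithin] with t ht ht0
  have ht0' : (0 : ℝ) < t := ht0
  rw [slope_def_field, h0, sub_zero, div_le_iff₀ ht0']
  linarith

/-- With `y` the midpoint of `y₀` and `x₀`, the half-size ball touches the large sphere only at
`x₀`. This provides the strict inequality that Hopf's lemma needs on the rest of the closed ball. -/
theorem closedBall_sdiff_singleton_subset_ball {E : Type*} [NormedAddCommGroup E]
    [InnerProductSpace ℝ E] {x₀ y₀ y : E} {R : ℝ} (hR : 0 < R) (hx₀ : ‖x₀ - y‖ = R)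
    (hy : y - y₀ = x₀ - y) :
    Metric.closedBall y R \ {x₀} ⊆ Metric.ball y₀ (2 * R) := by
  rintro x ⟨hx, hne⟩
  have hx' : ‖x - y‖ ≤ R := by simpa [dist_eq_norm] using hx
  have h1 := parallelogram_law_with_norm ℝ (x - y) (x₀ - y)
  have h2 : x - y + (x₀ - y) = x - y₀ := by rw [← hy]; abel
  have h3 : x - y - (x₀ - y) = x - x₀ := by abel
  rw [h2, h3, hx₀] at h1
  have h4 : 0 < ‖x - x₀‖ := norm_pos_iff.2 (sub_ne_zero.2 hne)
  have h5 : 0 ≤ ‖x - y‖ := norm_nonneg _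
  rw [Metric.mem_ball, dist_eq_norm]
  refine lt_of_pow_lt_pow_left₀ 2 (by positivity) ?_
  nlinarith

section

variable {d : ℕ}

/-- Strong maximum principle for `Δ u + ⟪b, ∇ u⟫ = 0`. -/
theorem eqOn_const_of_interior_max {Ω : Set (EuclideanSpace ℝ (Fin d))} (hΩ : IsOpen Ω)
    (hconn : IsPreconnected Ω) {u : EuclideanSpace ℝ (Fin d) → ℝ}
    {b : EuclideanSpace ℝ (Fin d) → EuclideanSpace ℝ (Fin d)} {M : ℝ}
    (hu : ∀ x ∈ Ω, ContDiffAt ℝ 2 u x) (hb : ContinuousOn b Ω)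
    (hL : ∀ x ∈ Ω, Laplacian.laplacian u x + inner ℝ (b x) (gradient u x) = 0)
    (hle : ∀ x ∈ Ω, u x ≤ M) {x₁ : EuclideanSpace ℝ (Fin d)} (hx₁ : x₁ ∈ Ω) (hx₁M : u x₁ = M) :
    ∀ x ∈ Ω, u x = M := by
  by_contra! hcon
  obtain ⟨x₂, hx₂, hx₂M⟩ := hcon
  have hucont : ContinuousOn u Ω := fun x hx => (hu x hx).continuousAt.continuousWithinAt
  set W : Set (EuclideanSpace ℝ (Fin d)) := Ω ∩ u ⁻¹' Iio M with hW
  have hWopen : IsOpen W := hucont.isOpen_inter_preimage hΩ isOpen_Iio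
  -- By connectedness, `{u < M}` being open, nonempty and relatively closed would fill `Ω`.
  suffices hcl : closure W ∩ Ω ⊆ W by
    have := hconn.subset_of_closure_inter_subset hWopen
      ⟨x₂, hx₂, hx₂, lt_of_le_of_ne (hle _ hx₂) hx₂M⟩ hcl hx₁
    exact absurd hx₁M (ne_of_lt this.2)
  rintro z ⟨hzW, hzΩ⟩
  by_contra hz
  have hzM : u z = M := by
    by_contra h
    exact hz ⟨hzΩ, lt_of_le_of_ne (hle _ hzΩ) h⟩
  obtain ⟨r, hr, hrΩ⟩ := Metric.nhds_basis_closedBall.mem_iff.1 (hΩ.mem_nhds hzΩ)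
  obtain ⟨y₀, hy₀W, hy₀⟩ := Metric.mem_closure_iff.1 hzW (r / 2) (by linarith)
  set K : Set (EuclideanSpace ℝ (Fin d)) := Metric.closedBall z r ∩ u ⁻¹' {M} with hK
  have hKcomp : IsCompact K := by
    refine (isCompact_closedBall z r).of_isClosed_subset ?_ inter_subset_left
    exact (hucont.mono hrΩ).preimage_isClosed_of_isClosed Metric.isClosed_closedBall
      isClosed_singleton
  have hzK : z ∈ K := ⟨Metric.mem_closedBall_self hr.le, hzM⟩
  -- `x₀` is a point of `{u = M}` nearest to `y₀`, so the open ball about `y₀` reaching `x₀` lies in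
  -- `W`; taking `y₀` within `r / 2` of `z` keeps it inside `closedBall z r`.
  obtain ⟨x₀, hx₀K, hx₀min⟩ := hKcomp.exists_isMinOn ⟨z, hzK⟩ (f := fun x => dist x y₀)
    (by fun_prop)
  have hx₀Ω : x₀ ∈ Ω := hrΩ hx₀K.1
  have hx₀M : u x₀ = M := hx₀K.2
  set R : ℝ := dist x₀ y₀ / 2 with hRdef
  have hx₀y₀ : x₀ ≠ y₀ := by
    rintro rfl
    exact absurd hx₀M (ne_of_lt hy₀W.2)
  have hR : 0 < R := half_pos (dist_pos.2 hx₀y₀)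
  have hRz : 2 * R ≤ dist z y₀ := by
    have : dist x₀ y₀ ≤ dist z y₀ := hx₀min hzK
    linarith
  have hballW : Metric.ball y₀ (2 * R) ⊆ W ∩ Metric.closedBall z r := by
    intro x hx
    have hx' : dist x y₀ < 2 * R := hx
    have h1 : x ∈ Metric.closedBall z r := by
      rw [Metric.mem_closedBall]
      have := dist_triangle x y₀ z
      rw [dist_comm y₀ z] at this
      linarith
    refine ⟨⟨hrΩ h1, lt_of_le_of_ne (hle _ (hrΩ h1)) fun h => ?_⟩, h1⟩
    have : dist x₀ y₀ ≤ dist x y₀ := hx₀min (show x ∈ K from ⟨h1, h⟩)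
    linarith
  set y : EuclideanSpace ℝ (Fin d) := (1 / 2 : ℝ) • (x₀ + y₀) with hy
  have hxy : x₀ - y = (1 / 2 : ℝ) • (x₀ - y₀) := by rw [hy]; module
  have hyy : y - y₀ = (1 / 2 : ℝ) • (x₀ - y₀) := by rw [hy]; module
  have hnorm : ‖x₀ - y‖ = R := by
    rw [hxy, norm_smul, ← dist_eq_norm]
    norm_num
    ring
  have hsub : Metric.closedBall y R \ {x₀} ⊆ W ∩ Metric.closedBall z r :=
    (closedBall_sdiff_singleton_subset_ball hR hnorm (hyy.trans hxy.symm)).trans hballW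
  obtain ⟨B, hB⟩ := (isCompact_closedBall z r).exists_bound_of_continuousOn (hb.mono hrΩ)
  obtain ⟨c, hc, hdec⟩ := hopf_boundary_point (b := b) (M := M) (B := B) hR hnorm
    (fun x hx => hu x (hsub hx).1.1) (fun x hx => (hsub hx).1.2)
    (by
      rw [← hx₀M]
      exact (hu x₀ hx₀Ω).continuousAt.continuousWithinAt)
    (fun x hx => hL x (hsub hx).1.1) (fun x hx => hB x (hsub hx).2)
  -- The derivative vanishes at this interior maximum, contradicting the linear decrease from Hopf's
  -- lemma.
  have hloc : IsLocalMax u x₀ := by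
    filter_upwards [hΩ.mem_nhds hx₀Ω] with x hx
    rw [hx₀M]
    exact hle x hx
  have hd : DifferentiableAt ℝ u (x₀ + (0 : ℝ) • (y - x₀)) := by
    simpa using (hu x₀ hx₀Ω).differentiableAt (by simp)
  have hder := hasDerivAt_comp_line hd
  simp only [zero_smul, add_zero, hloc.fderiv_eq_zero, zero_apply] at hder
  have := le_neg_of_hasDerivWithinAt_of_le (M := M) (c := c) hder.hasDerivWithinAt (by simp [hx₀M])
    (by
      filter_upwards [Ioo_mem_nhdsGT (show (0 : ℝ) < 1 / 2 by norm_num)] with t ht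
      exact hdec t ht)
  linarith

/-! ### Boundary geometry: defining function, normal, interior ball. -/

/-- Take `F x = γ (P x) - ⟪x, e⟫`. As `P e = 0`, its derivative along `e` is `-1`, so the gradient
does not vanish. -/
theorem HasC2HolderBoundary.exists_defining_function {α : NNReal}
    {Ω : Set (EuclideanSpace ℝ (Fin d))} (h : HasC2HolderBoundary α Ω) (hΩ : IsOpen Ω)
    {x₀ : EuclideanSpace ℝ (Fin d)} (hx₀ : x₀ ∈ frontier Ω) :
    ∃ F : EuclideanSpace ℝ (Fin d) → ℝ, ContDiffAt ℝ 2 F x₀ ∧ F x₀ = 0 ∧ gradient F x₀ ≠ 0 ∧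
      ∀ᶠ x in 𝓝 x₀, (x ∈ Ω ↔ F x < 0) := by
  obtain ⟨r, e, γ, C, hr, he, hγ, -, hmem⟩ := h x₀ hx₀
  set P := (Submodule.span ℝ {e})ᗮ.orthogonalProjectionOnto with hP
  set F : EuclideanSpace ℝ (Fin d) → ℝ := fun x => γ (P x) - inner ℝ x e with hF
  have hγ' : ContDiffAt ℝ 2 γ (P x₀) := hγ.contDiffAt (Metric.ball_mem_nhds _ hr)
  have hiff : ∀ᶠ x in 𝓝 x₀, (x ∈ Ω ↔ F x < 0) := by
    filter_upwards [Metric.ball_mem_nhds x₀ hr] with x hx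
    rw [hmem x hx, hF, sub_neg]
  have hFc : ContDiffAt ℝ 2 F x₀ :=
    (hγ'.comp x₀ P.contDiff.contDiffAt).sub (contDiffAt_id.inner ℝ contDiffAt_const)
  refine ⟨F, hFc, ?_, ?_, hiff⟩
  · have h1 : ¬ F x₀ < 0 := by
      rw [← hiff.self_of_nhds]
      have := hx₀.2
      rwa [hΩ.interior_eq] at this
    refine le_antisymm ?_ (not_lt.1 h1)
    by_contra! hpos
    have h2 : ∀ᶠ x in 𝓝 x₀, x ∉ Ω := by
      filter_upwards [hiff, hFc.continuousAt.eventually (lt_mem_nhds hpos)] with x hx hx'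
      rw [hx]
      exact hx'.not_gt
    exact (mem_closure_iff_frequently.1 hx₀.1) h2
  · intro hzero
    have h1 : fderiv ℝ F x₀ e = 0 := by rw [← inner_gradient_eq_fderiv, hzero, inner_zero_left]
    have h2 : HasFDerivAt F ((fderiv ℝ γ (P x₀)).comp (P : EuclideanSpace ℝ (Fin d) →L[ℝ] _)
        - innerSL ℝ e) x₀ := by
      have a1 := (hγ'.differentiableAt (by simp)).hasFDerivAt.comp x₀ P.hasFDerivAt
      have a2 : HasFDerivAt (fun x => inner ℝ x e) (innerSL ℝ e) x₀ := by
        refine (innerSL ℝ e).hasFDerivAt.congr_of_eventuallyEq (Eventually.of_forall fun x => ?_)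
        simp [real_inner_comm]
      exact a1.sub a2
    have h3 : P e = 0 := by
      rw [hP, Submodule.orthogonalProjectionOnto_eq_zero_iff]
      exact Submodule.le_orthogonal_orthogonal _ (Submodule.mem_span_singleton_self e)
    rw [h2.fderiv] at h1
    simp [h3, he] at h1

/-- The derivative is Lipschitz near `x₀`, so the mean value inequality for `F` minus its linear
part gives a quadratic remainder. This is what yields an interior ball. -/
theorem exists_norm_sub_sub_fderiv_le_of_contDiffAt {E : Type*} [NormedAddCommGroup E]
    [NormedSpace ℝ E] {F : E → ℝ} {x₀ : E} (hF : ContDiffAt ℝ 2 F x₀) :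
    ∃ K : ℝ, 0 ≤ K ∧ ∀ᶠ x in 𝓝 x₀, ‖F x - F x₀ - fderiv ℝ F x₀ (x - x₀)‖ ≤ K * ‖x - x₀‖ ^ 2 := by
  have hd : ContDiffAt ℝ 1 (fderiv ℝ F) x₀ := hF.fderiv_right (m := 1) (by norm_num)
  obtain ⟨K, s, hs, hlip⟩ := (hd.hasStrictFDerivAt (by simp)).exists_lipschitzOnWith
  have hev : ∀ᶠ y in 𝓝 x₀, DifferentiableAt ℝ F y ∧ y ∈ s :=
    ((hF.eventually (by simp)).mono fun y hy => hy.differentiableAt (by simp)).and hs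
  obtain ⟨δ, hδ, hball⟩ := Metric.eventually_nhds_iff_ball.1 hev
  refine ⟨K, K.2, ?_⟩
  filter_upwards [Metric.ball_mem_nhds x₀ hδ] with x hx
  have hsub : Metric.closedBall x₀ (dist x x₀) ⊆ Metric.ball x₀ δ :=
    Metric.closedBall_subset_ball hx
  have := (convex_closedBall x₀ (dist x x₀)).norm_image_sub_le_of_norm_fderiv_le'
    (f := F) (φ := fderiv ℝ F x₀) (C := K * ‖x - x₀‖) (x := x₀) (y := x)
    (fun z hz => (hball z (hsub hz)).1)
    (fun z hz => by
      have h1 := hlip.norm_sub_le (hball z (hsub hz)).2 (hball x₀ (Metric.mem_ball_self hδ)).2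
      have h2 : ‖z - x₀‖ ≤ ‖x - x₀‖ := by simpa [dist_eq_norm] using hz
      exact h1.trans (mul_le_mul_of_nonneg_left h2 K.2))
    (Metric.mem_closedBall_self dist_nonneg) (by simp)
  rw [pow_two, ← mul_assoc]
  exact this

theorem eventually_neg_of_hasDerivAt {g : ℝ → ℝ} {g' : ℝ} (hg : HasDerivAt g g' 0)
    (h0 : g 0 = 0) (hneg : g' < 0) : ∀ᶠ t in 𝓝[>] (0 : ℝ), g t < 0 := by
  have h1 := hasDerivWithinAt_iff_tendsto_slope.1 (hg.hasDerivWithinAt (s := Ici 0))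
  rw [Ici_sdiff_left] at h1
  filter_upwards [h1.eventually (gt_mem_nhds hneg), self_mem_nhdsWithin] with t ht ht0
  have ht0' : (0 : ℝ) < t := ht0
  rw [slope_def_field, h0, sub_zero, sub_zero, div_lt_iff₀ ht0'] at ht
  linarith

/-- A `C²` domain has an outer unit normal, and satisfies an interior ball condition, at each
boundary point. -/
theorem HasC2HolderBoundary.exists_normal {α : NNReal}
    {Ω : Set (EuclideanSpace ℝ (Fin d))} (h : HasC2HolderBoundary α Ω) (hΩ : IsOpen Ω)
    {x₀ : EuclideanSpace ℝ (Fin d)} (hx₀ : x₀ ∈ frontier Ω) :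
    ∃ ν, IsOuterUnitNormal Ω x₀ ν ∧ ∃ K : ℝ, 0 ≤ K ∧
      ∀ᶠ x in 𝓝 x₀, K * ‖x - x₀‖ ^ 2 < - inner ℝ (x - x₀) ν → x ∈ Ω := by
  obtain ⟨F, hF, hF0, hgrad, hiff⟩ := h.exists_defining_function hΩ hx₀
  have hpos : 0 < ‖gradient F x₀‖ := norm_pos_iff.2 hgrad
  set ν := ‖gradient F x₀‖⁻¹ • gradient F x₀ with hν
  have hfd : ∀ v, fderiv ℝ F x₀ v = ‖gradient F x₀‖ * inner ℝ v ν := by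
    intro v
    rw [← inner_gradient_eq_fderiv, hν, inner_smul_right, real_inner_comm]
    field_simp
  have hdiff : DifferentiableAt ℝ F x₀ := hF.differentiableAt (by simp)
  have hline : ∀ v, HasDerivAt (fun s : ℝ => F (x₀ + s • v)) (fderiv ℝ F x₀ v) 0 := by
    intro v
    have := hasDerivAt_comp_line (v := v) (t := 0) (x := x₀) (by simpa using hdiff)
    simpa using this
  have htend : ∀ v, Tendsto (fun s : ℝ => x₀ + s • v) (𝓝[>] 0) (𝓝 x₀) := fun v =>
    (tendsto_add_smul_nhds x₀ v).mono_left nhdsWithin_le_nhds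
  refine ⟨ν, ⟨by rw [hν, norm_smul, norm_inv, norm_norm, inv_mul_cancel₀ hpos.ne'],
    fun v => ⟨fun hv => ?_, fun hv => ?_⟩⟩, ?_⟩
  · filter_upwards [eventually_neg_of_hasDerivAt (hline v) (by simp [hF0])
      (by rw [hfd]; exact mul_neg_of_pos_of_neg hpos hv), (htend v).eventually hiff] with t h1 h2
    exact h2.2 h1
  · have hcont : ∀ᶠ x in 𝓝 x₀, ContinuousAt F x :=
      (hF.eventually (by simp)).mono fun y hy => hy.continuousAt
    filter_upwards [eventually_neg_of_hasDerivAt (hline v).neg (by simp [hF0])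
      (by rw [hfd]; exact neg_neg_of_pos (mul_pos hpos hv)),
      (htend v).eventually hiff.eventually_nhds, (htend v).eventually hcont] with t h1 h2 h3
    have h4 : 0 < F (x₀ + t • v) := by simpa using h1
    intro hcl
    refine (mem_closure_iff_frequently.1 hcl) ?_
    filter_upwards [h2, h3.eventually (lt_mem_nhds h4)] with x hx hx'
    rw [hx]
    exact hx'.not_gt
  -- Near `x₀`, `F x ≤ ‖∇F‖ ⟪x - x₀, ν⟫ + K ‖x - x₀‖²`, which is negative in the stated region.
  · obtain ⟨K, hK, hbound⟩ := exists_norm_sub_sub_fderiv_le_of_contDiffAt hF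
    refine ⟨K / ‖gradient F x₀‖, by positivity, ?_⟩
    filter_upwards [hiff, hbound] with x h1 h2 h3
    rw [h1]
    rw [hF0, hfd, sub_zero] at h2
    have h4 := (abs_le.1 h2).2
    have h5 : K * ‖x - x₀‖ ^ 2 < ‖gradient F x₀‖ * -inner ℝ (x - x₀) ν := by
      rw [div_mul_eq_mul_div, div_lt_iff₀ hpos] at h3
      linarith
    linarith

/-! ### Zero flux forces a constant. -/

/-- If `u` has a limit in `[-∞, ∞)` at each boundary point of a bounded open set, then its supremum
is attained either in the set, or as the limit at a boundary point. -/
theorem exists_mem_or_frontier_sup {X : Type*} [PseudoMetricSpace X] [ProperSpace X] {Ω : Set X}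
    (hΩ : IsOpen Ω) (hbdd : Bornology.IsBounded Ω) (hne : Ω.Nonempty) {u : X → ℝ}
    (hu : ContinuousOn u Ω)
    (hlim : ∀ p ∈ frontier Ω,
      (∃ l, Tendsto u (𝓝[Ω] p) (𝓝 l)) ∨ Tendsto u (𝓝[Ω] p) atBot) :
    (∃ p ∈ Ω, ∀ x ∈ Ω, u x ≤ u p) ∨
      ∃ p ∈ frontier Ω, ∃ l, Tendsto u (𝓝[Ω] p) (𝓝 l) ∧ ∀ x ∈ Ω, u x ≤ l := by
  -- Working in `EReal` avoids having to know beforehand that `u` is bounded above.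
  obtain ⟨v, -, hv, hvmem⟩ := exists_seq_tendsto_sSup
    (S := (fun x => (u x : EReal)) '' Ω) (hne.image _) (OrderTop.bddAbove _)
  choose z hzΩ hzv using hvmem
  have hle : ∀ x ∈ Ω, (u x : EReal) ≤ sSup ((fun x => (u x : EReal)) '' Ω) := fun x hx =>
    le_sSup (mem_image_of_mem _ hx)
  set s := sSup ((fun x => (u x : EReal)) '' Ω)
  obtain ⟨p, hp, φ, hφ, hφp⟩ := (hbdd.isCompact_closure).tendsto_subseq
    (fun n => subset_closure (hzΩ n))
  have hvφ : Tendsto (fun n => (u (z (φ n)) : EReal)) atTop (𝓝 s) := by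
    have := hv.comp hφ.tendsto_atTop
    simpa only [Function.comp_def, ← hzv] using this
  have hzp : Tendsto (z ∘ φ) atTop (𝓝[Ω] p) :=
    tendsto_nhdsWithin_iff.2 ⟨hφp, Eventually.of_forall fun n => hzΩ _⟩
  have key : ∀ l, Tendsto u (𝓝[Ω] p) (𝓝 l) → ∀ x ∈ Ω, u x ≤ l := by
    intro l hl x hx
    have h1 : Tendsto (fun n => (u (z (φ n)) : EReal)) atTop (𝓝 (l : EReal)) :=
      (continuous_coe_real_ereal.tendsto l).comp (hl.comp hzp)
    have := hle x hx
    rw [tendsto_nhds_unique hvφ h1] at this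
    exact_mod_cast this
  by_cases hpΩ : p ∈ Ω
  · exact Or.inl ⟨p, hpΩ, key _ (hu p hpΩ)⟩
  · have hpf : p ∈ frontier Ω := ⟨hp, by rwa [hΩ.interior_eq]⟩
    rcases hlim p hpf with ⟨l, hl⟩ | hbot
    · exact Or.inr ⟨p, hpf, l, hl, key l hl⟩
    · exfalso
      obtain ⟨x, hx⟩ := hne
      have h1 : Tendsto (fun n => (u (z (φ n)) : EReal)) atTop (𝓝 ⊥) :=
        EReal.tendsto_coe_atBot.comp (hbot.comp hzp)
      have := hle x hx
      rw [tendsto_nhds_unique hvφ h1] at this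
      exact (EReal.bot_lt_coe _).not_ge this

/-- Solutions of `m Δ u + ⟪∇ m, ∇ u⟫ = 0`, that is `∇ · (m ∇ u) = 0`, without normal flux are
constant. The weight `m` may vanish at boundary points where `u` tends to `-∞`. -/
theorem exists_eqOn_const_of_noFlux {α : NNReal} {Ω : Set (EuclideanSpace ℝ (Fin d))}
    (hΩ : IsOpen Ω) (hbdd : Bornology.IsBounded Ω) (hconn : IsConnected Ω)
    (hbdry : HasC2HolderBoundary α Ω) {m u : EuclideanSpace ℝ (Fin d) → ℝ}
    (hm : ∀ x ∈ Ω, 0 < m x) (hm1 : IsC1UpTo Ω (closure Ω) m)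
    (hu : ContDiffOn ℝ 2 u Ω)
    (hpde : ∀ x ∈ Ω, m x * Laplacian.laplacian u x + inner ℝ (gradient m x) (gradient u x) = 0)
    (hflux : ∀ x ∈ frontier Ω, ∀ ν, IsOuterUnitNormal Ω x ν →
      Tendsto (fun y => m y * inner ℝ (gradient u y) ν) (𝓝[Ω] x) (𝓝 0))
    (hlim : ∀ p ∈ frontier Ω,
      ((∃ l, 0 < l ∧ Tendsto m (𝓝[Ω] p) (𝓝 l)) ∧ ∃ l, Tendsto u (𝓝[Ω] p) (𝓝 l)) ∨
        Tendsto u (𝓝[Ω] p) atBot) :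
    ∃ c, ∀ x ∈ Ω, u x = c := by
  have huat : ∀ x ∈ Ω, ContDiffAt ℝ 2 u x := fun x hx => hu.contDiffAt (hΩ.mem_nhds hx)
  set b : EuclideanSpace ℝ (Fin d) → EuclideanSpace ℝ (Fin d) :=
    fun x => (m x)⁻¹ • gradient m x with hb
  have hbL : ∀ x ∈ Ω, Laplacian.laplacian u x + inner ℝ (b x) (gradient u x) = 0 := by
    intro x hx
    have h1 := hm x hx
    simp only [hb, real_inner_smul_left]
    field_simp
    linarith [hpde x hx]
  have hgradm : ContinuousOn (gradient m) Ω := by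
    have := hm1.1.continuousOn_fderiv_of_isOpen hΩ (by simp)
    exact (InnerProductSpace.toDual ℝ _).symm.continuous.comp_continuousOn this
  have hbcont : ContinuousOn b Ω :=
    (hm1.1.continuousOn.inv₀ fun x hx => (hm x hx).ne').smul hgradm
  rcases exists_mem_or_frontier_sup hΩ hbdd hconn.nonempty hu.continuousOn
    (fun p hp => (hlim p hp).imp_left And.right) with ⟨p, hp, hmax⟩ | ⟨p, hp, M, hM, hmax⟩
  · exact ⟨u p, eqOn_const_of_interior_max hΩ hconn.isPreconnected huat hbcont hbL hmax hp rfl⟩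
  by_cases hatt : ∃ x ∈ Ω, u x = M
  · obtain ⟨x, hx, hxM⟩ := hatt
    exact ⟨M, eqOn_const_of_interior_max hΩ hconn.isPreconnected huat hbcont hbL hmax hx hxM⟩
  exfalso
  have hlt : ∀ x ∈ Ω, u x < M := fun x hx =>
    lt_of_le_of_ne (hmax x hx) fun h => hatt ⟨x, hx, h⟩
  have hpne : (𝓝[Ω] p).NeBot := mem_closure_iff_nhdsWithin_neBot.1 hp.1
  obtain ⟨l, hl, hml⟩ : ∃ l, 0 < l ∧ Tendsto m (𝓝[Ω] p) (𝓝 l) := by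
    rcases hlim p hp with h | h
    · exact h.1
    · exact absurd hM (not_tendsto_nhds_of_tendsto_atBot h M)
  obtain ⟨L, hL⟩ := (hm1.2 p hp.1).2
  obtain ⟨ν, hν, K, hK, hball⟩ := hbdry.exists_normal hΩ hp
  have hbbound : ∀ᶠ x in 𝓝[Ω] p, ‖b x‖ ≤ (l / 2)⁻¹ * (‖L‖ + 1) := by
    filter_upwards [hml.eventually (lt_mem_nhds (half_lt_self hl)),
      hL.norm.eventually (gt_mem_nhds (lt_add_one ‖L‖))] with x h1 h2
    have h3 : ‖gradient m x‖ = ‖fderiv ℝ m x‖ := by simp [gradient]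
    have h4 : 0 < l / 2 := half_pos hl
    rw [hb, norm_smul, norm_inv, h3, Real.norm_of_nonneg (h4.trans h1).le]
    gcongr
  obtain ⟨δ, hδ, hδball⟩ := Metric.eventually_nhds_iff_ball.1
    (hball.and (eventually_nhdsWithin_iff.1 hbbound))
  -- Points of the ball of radius `R` tangent at `p` satisfy `‖x - p‖² ≤ -2R ⟪x - p, ν⟫`; with `2RK
  -- < 1` this puts them in `Ω`, and `2R < δ` keeps the bound on `b`.
  obtain ⟨R, hR, hRδ, hRK⟩ : ∃ R : ℝ, 0 < R ∧ 2 * R < δ ∧ 2 * R * K < 1 := by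
    have t1 : Tendsto (fun R : ℝ => 2 * R) (𝓝[>] 0) (𝓝 0) := by
      have : Continuous fun R : ℝ => 2 * R := by fun_prop
      simpa using (this.tendsto 0).mono_left nhdsWithin_le_nhds
    have t2 : Tendsto (fun R : ℝ => 2 * R * K) (𝓝[>] 0) (𝓝 0) := by
      simpa using t1.mul_const K
    obtain ⟨R, h1, h2, h3⟩ := ((t1.eventually (gt_mem_nhds hδ)).and
      ((t2.eventually (gt_mem_nhds one_pos)).and self_mem_nhdsWithin)).exists
    exact ⟨R, h3, h1, h2⟩
  set y := p - R • ν with hy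
  have hyp : y - p = (-R) • ν := by rw [hy]; module
  have hpy : ‖p - y‖ = R := by
    rw [norm_sub_rev, hyp, norm_smul, hν.1, norm_neg, Real.norm_of_nonneg hR.le, mul_one]
  have hsub : Metric.closedBall y R \ {p} ⊆ Ω ∩ Metric.ball p δ := by
    rintro x ⟨hx, hxp⟩
    have hx' : ‖x - y‖ ≤ R := by simpa [dist_eq_norm] using hx
    have h1 : x ∈ Metric.ball p δ := by
      rw [Metric.mem_ball, dist_eq_norm]
      have := norm_sub_le_norm_sub_add_norm_sub x y p
      rw [norm_sub_rev y p] at this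
      linarith
    refine ⟨(hδball x h1).1 ?_, h1⟩
    have h2 : x - y = (x - p) + R • ν := by rw [hy]; module
    have h3 : ‖x - y‖ ^ 2 ≤ R ^ 2 := by gcongr
    rw [h2, norm_add_sq_real, norm_smul, hν.1, Real.norm_of_nonneg hR.le, inner_smul_right] at h3
    have h4 : 0 < ‖x - p‖ ^ 2 := by
      have : 0 < ‖x - p‖ := norm_pos_iff.2 (sub_ne_zero.2 hxp)
      positivity
    have h5 : 2 * R * (K * ‖x - p‖ ^ 2) < 2 * R * -inner ℝ (x - p) ν := by nlinarith
    exact lt_of_mul_lt_mul_left h5 (by positivity)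
  have hM' : Tendsto u (𝓝[Metric.closedBall y R \ {p}] p) (𝓝 M) :=
    hM.mono_left (nhdsWithin_mono _ fun x hx => (hsub hx).1)
  obtain ⟨c, hc, hdec⟩ := hopf_boundary_point (b := b) hR hpy
    (fun x hx => huat x (hsub hx).1) (fun x hx => hlt x (hsub hx).1) hM'
    (fun x hx => hbL x (hsub hx).1) (fun x hx => (hδball x (hsub hx).2).2 (hsub hx).1)
  have hpath : ∀ t ∈ Ioo (0 : ℝ) 1, p + t • (y - p) ∈ Ω := by
    intro t ht
    refine (hsub ⟨?_, ?_⟩).1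
    · have : p + t • (y - p) - y = (1 - t) • (p - y) := by module
      rw [Metric.mem_closedBall, dist_eq_norm, this, norm_smul, hpy,
        Real.norm_of_nonneg (by linarith [ht.2])]
      nlinarith [ht.1]
    · simp only [mem_singleton_iff, add_eq_left, smul_eq_zero, not_or]
      refine ⟨ht.1.ne', ?_⟩
      rw [← norm_eq_zero, norm_sub_rev, hpy]
      exact hR.ne'
  have hpathlim : Tendsto (fun t : ℝ => p + t • (y - p)) (𝓝[>] 0) (𝓝[Ω] p) := by
    refine tendsto_nhdsWithin_iff.2
      ⟨(tendsto_add_smul_nhds p _).mono_left nhdsWithin_le_nhds, ?_⟩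
    filter_upwards [Ioo_mem_nhdsGT one_pos] with t ht using hpath t ht
  set g : ℝ → ℝ := Function.update (fun t => u (p + t • (y - p))) 0 M with hg
  have hgev : ∀ t ∈ Ioo (0 : ℝ) 1, g =ᶠ[𝓝 t] fun t => u (p + t • (y - p)) := by
    intro t ht
    filter_upwards [isOpen_ne.mem_nhds ht.1.ne'] with s hs
    exact Function.update_of_ne hs _ _
  have hgder : ∀ t ∈ Ioo (0 : ℝ) 1,
      HasDerivAt g (fderiv ℝ u (p + t • (y - p)) (y - p)) t := by
    intro t ht
    exact (hasDerivAt_comp_line ((huat _ (hpath t ht)).differentiableAt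
      (by simp))).congr_of_eventuallyEq (hgev t ht)
  -- The one-sided derivative at `p` is the limit of the derivatives inside. These are `-R` times
  -- the normal flux divided by `m`, and `m` tends to `l > 0`.
  have hgd : HasDerivWithinAt g 0 (Ici 0) 0 := by
    refine hasDerivWithinAt_Ici_of_tendsto_deriv (s := Ioo 0 1)
      (fun t ht => (hgder t ht).differentiableAt.differentiableWithinAt) ?_
      (Ioo_mem_nhdsGT one_pos) ?_
    · rw [hg, continuousWithinAt_update_same]
      refine (hM.comp hpathlim).mono_left (nhdsWithin_mono _ fun t ht => ht.1.1)
    · have h1 : Tendsto (fun t : ℝ => -R * ((m (p + t • (y - p)))⁻¹ *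
          (m (p + t • (y - p)) * inner ℝ (gradient u (p + t • (y - p))) ν))) (𝓝[>] 0)
          (𝓝 (-R * (l⁻¹ * 0))) :=
        (((hml.inv₀ hl.ne').mul (hflux p hp ν hν)).comp hpathlim).const_mul _
      rw [mul_zero, mul_zero] at h1
      refine h1.congr' ?_
      filter_upwards [Ioo_mem_nhdsGT one_pos] with t ht
      have h2 := (hm _ (hpath t ht)).ne'
      rw [(hgder t ht).deriv, inv_mul_cancel_left₀ h2, ← inner_gradient_eq_fderiv, hyp,
        inner_smul_right]
  have := le_neg_of_hasDerivWithinAt_of_le (M := M) (c := c) hgd (by simp [hg]) (by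
    filter_upwards [Ioo_mem_nhdsGT (show (0 : ℝ) < 1 / 2 by norm_num)] with t ht
    have := hdec t ht
    rwa [hg, Function.update_of_ne ht.1.ne'])
  linarith

end

/-! ### The scalar equation `a log s + k s = c`. -/

section scalar

variable {a : ℝ} {k : ℝ → ℝ}

theorem strictMonoOn_log_add (ha : 0 < a) (hk : MonotoneOn k (Ioi 0)) :
    StrictMonoOn (fun s => a * Real.log s + k s) (Ioi 0) := by
  intro s hs t ht hst
  have h1 := mul_lt_mul_of_pos_left (Real.log_lt_log hs hst) ha
  have h2 := hk hs ht hst.le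
  simp only
  linarith

theorem exists_log_add_eq (ha : 0 < a) (hk : MonotoneOn k (Ioi 0)) (hkc : ContinuousOn k (Ioi 0))
    (c : ℝ) : ∃ s, 0 < s ∧ a * Real.log s + k s = c := by
  -- `exp q` is the solution with `k` frozen at `k 1`. Monotonicity of `k` makes the value at most
  -- `c` at `exp (min 0 q)` and at least `c` at `exp (max 0 q)`.
  set q := (c - k 1) / a with hq
  have haq : a * q = c - k 1 := by rw [hq]; field_simp
  have h1 : Real.exp (min 0 q) ≤ 1 := Real.exp_le_one_iff.2 (min_le_left _ _)
  have h2 : 1 ≤ Real.exp (max 0 q) := Real.one_le_exp (le_max_left _ _)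
  have hsub : Icc (Real.exp (min 0 q)) (Real.exp (max 0 q)) ⊆ Ioi 0 := fun s hs =>
    (Real.exp_pos _).trans_le hs.1
  have hcont : ContinuousOn (fun s => a * Real.log s + k s)
      (Icc (Real.exp (min 0 q)) (Real.exp (max 0 q))) :=
    (continuousOn_const.mul (Real.continuousOn_log.mono fun s hs => (hsub hs).ne')).add
      (hkc.mono hsub)
  obtain ⟨s, hs, hsc⟩ := intermediate_value_Icc (h1.trans h2) hcont (show c ∈ Icc _ _ by
    simp only [Real.log_exp]
    constructor
    · have := hk (Real.exp_pos _) (mem_Ioi.2 one_pos) h1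
      have := mul_le_mul_of_nonneg_left (min_le_right 0 q) ha.le
      linarith
    · have := hk (mem_Ioi.2 one_pos) (Real.exp_pos _) h2
      have := mul_le_mul_of_nonneg_left (le_max_right 0 q) ha.le
      linarith)
  exact ⟨s, hsub hs, hsc⟩

theorem log_sub_log_le (ha : 0 < a) (hk : MonotoneOn k (Ioi 0)) {s t c c' : ℝ} (hs : 0 < s)
    (ht : 0 < t) (hsc : a * Real.log s + k s = c) (htc : a * Real.log t + k t = c')
    (hcc : c ≤ c') : a * |Real.log t - Real.log s| ≤ c' - c := by
  have hst : s ≤ t := by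
    rw [← (strictMonoOn_log_add ha hk).le_iff_le hs ht, hsc, htc]
    exact hcc
  have h1 := Real.log_le_log hs hst
  have h2 := hk hs ht hst
  rw [abs_of_nonneg (by linarith)]
  linarith

theorem abs_log_sub_log_le (ha : 0 < a) (hk : MonotoneOn k (Ioi 0)) {s t c c' : ℝ} (hs : 0 < s)
    (ht : 0 < t) (hsc : a * Real.log s + k s = c) (htc : a * Real.log t + k t = c') :
    a * |Real.log t - Real.log s| ≤ |c' - c| := by
  rcases le_total c c' with hcc | hcc
  · exact (log_sub_log_le ha hk hs ht hsc htc hcc).trans (le_abs_self _)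
  · rw [abs_sub_comm, abs_sub_comm c']
    exact (log_sub_log_le ha hk ht hs htc hsc hcc).trans (le_abs_self _)

/-- By taking logarithms, uniqueness of the normalising constant becomes uniqueness of the level
`-(σ²/2) log Z`. -/
theorem eq_inv_mul_exp_iff {σ s v Z : ℝ} (hσ : 0 < σ) (hs : 0 < s) (hZ : 0 < Z) :
    s = Z⁻¹ * Real.exp (-2 * v / σ ^ 2) ↔
      σ ^ 2 / 2 * Real.log s + v = -(σ ^ 2 / 2 * Real.log Z) := by
  have h1 : Z⁻¹ * Real.exp (-2 * v / σ ^ 2) = Real.exp (-Real.log Z + -2 * v / σ ^ 2) := by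
    rw [Real.exp_add, Real.exp_neg, Real.exp_log hZ]
  rw [h1]
  constructor
  · intro h
    rw [h, Real.log_exp]
    field_simp
    ring
  · intro h
    rw [← Real.exp_log hs]
    congr 1
    field_simp
    field_simp at h
    linarith

end scalar

/-! ### Regularity of the implicit solution, up to the boundary. -/

section implicit

variable {E : Type*} [NormedAddCommGroup E] [NormedSpace ℝ E]
  {Ω : Set E} {h : E → ℝ → ℝ} {a c : ℝ} {m : E → ℝ}

theorem fderiv_snd_nonneg (hΩ : IsOpen Ω) (h_mono : ∀ x ∈ Ω, MonotoneOn (h x) (Ioi 0))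
    (h_C1 : ContDiffOn ℝ 1 (fun p : E × ℝ => h p.1 p.2) (Ω ×ˢ Ioi 0)) {p : E × ℝ}
    (hp : p ∈ Ω ×ˢ Ioi 0) : 0 ≤ fderiv ℝ (fun p : E × ℝ => h p.1 p.2) p (0, 1) := by
  have hd : HasFDerivAt (fun p : E × ℝ => h p.1 p.2) _ (p.1, p.2) :=
    ((h_C1.contDiffAt ((hΩ.prod isOpen_Ioi).mem_nhds hp)).differentiableAt (by simp)).hasFDerivAt
  have h1 : HasDerivAt (fun s : ℝ => (p.1, s)) ((0 : E), (1 : ℝ)) p.2 :=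
    (hasDerivAt_const p.2 p.1).prodMk (hasDerivAt_id p.2)
  have h2 : HasDerivAt (h p.1) (fderiv ℝ (fun p : E × ℝ => h p.1 p.2) p (0, 1)) p.2 :=
    hd.comp_hasDerivAt p.2 h1
  have h3 := hasDerivWithinAt_iff_tendsto_slope.1 (h2.hasDerivWithinAt (s := Ici p.2))
  rw [Ici_sdiff_left] at h3
  refine ge_of_tendsto h3 ?_
  filter_upwards [self_mem_nhdsWithin] with s hs
  have hs' : p.2 < s := hs
  rw [slope_def_field]
  exact div_nonneg (sub_nonneg.2 (h_mono _ hp.1 hp.2 (lt_trans hp.2 hs') hs'.le))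
    (sub_nonneg.2 hs'.le)

theorem hasFDerivAt_log_add {p : E × ℝ} (hp : 0 < p.2)
    (hd : DifferentiableAt ℝ (fun p : E × ℝ => h p.1 p.2) p) :
    HasFDerivAt (fun p : E × ℝ => a * Real.log p.2 + h p.1 p.2)
      ((a * p.2⁻¹) • ContinuousLinearMap.snd ℝ E ℝ + fderiv ℝ (fun p : E × ℝ => h p.1 p.2) p) p := by
  have h1 : HasFDerivAt (fun p : E × ℝ => a * Real.log p.2)
      ((a * p.2⁻¹) • ContinuousLinearMap.snd ℝ E ℝ) p := by
    have := ((hasFDerivAt_snd (𝕜 := ℝ) (p := p)).log hp.ne').const_mul a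
    rwa [smul_smul] at this
  exact h1.add hd.hasFDerivAt

/-- Regularity of a function defined implicitly by `a log m + h(x, m) = c`. -/
theorem contDiffOn_of_log_add_eq [CompleteSpace E] (hΩ : IsOpen Ω) (ha : 0 < a)
    (h_mono : ∀ x ∈ Ω, MonotoneOn (h x) (Ioi 0))
    (h_C2 : ContDiffOn ℝ 2 (fun p : E × ℝ => h p.1 p.2) (Ω ×ˢ Ioi 0))
    (hpos : ∀ x ∈ Ω, 0 < m x) (hm : ∀ x ∈ Ω, a * Real.log (m x) + h x (m x) = c) :
    ContDiffOn ℝ 2 m Ω := by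
  intro x hx
  have hmem : (x, m x) ∈ Ω ×ˢ Ioi (0 : ℝ) := ⟨hx, hpos x hx⟩
  have hh := h_C2.contDiffAt ((hΩ.prod isOpen_Ioi).mem_nhds hmem)
  have hΦ : ContDiffAt ℝ 2 (fun p : E × ℝ => a * Real.log p.2 + h p.1 p.2) (x, m x) :=
    (contDiffAt_const.mul (contDiffAt_snd.log (hpos x hx).ne')).add hh
  have hfd := (hasFDerivAt_log_add (a := a) (h := h) (p := (x, m x)) (hpos x hx)
    (hh.differentiableAt (by simp))).fderiv
  have hnn := fderiv_snd_nonneg hΩ h_mono (h_C2.of_le (by norm_num)) hmem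
  have hinv : (fderiv ℝ (fun p : E × ℝ => a * Real.log p.2 + h p.1 p.2) (x, m x) ∘L
      .inr ℝ E ℝ).IsInvertible := by
    have hq : 0 < a * (m x)⁻¹ + fderiv ℝ (fun p : E × ℝ => h p.1 p.2) (x, m x) (0, 1) := by
      have := mul_pos ha (inv_pos.2 (hpos x hx))
      linarith
    refine ⟨ContinuousLinearEquiv.unitsEquivAut ℝ (Units.mk0 _ hq.ne'), ?_⟩
    ext
    rw [hfd]
    simp
  have hev := hΦ.eventually_apply_implicitFunction (by simp) hinv
  have hcd := hΦ.contDiffAt_implicitFunction (by simp) hinv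
  have hself := hΦ.implicitFunction_apply_self (by simp) hinv
  refine (hcd.congr_of_eventuallyEq ?_).contDiffWithinAt
  have hψpos := hcd.continuousAt.eventually (lt_mem_nhds (by rw [hself]; exact hpos x hx))
  -- Continuity of `m` is not known beforehand: it agrees with the implicit function because the
  -- scalar equation at `z` has only one positive root.
  filter_upwards [hev, hψpos, hΩ.mem_nhds hx] with z h1 h2 h3
  refine (strictMonoOn_log_add ha (h_mono z h3)).injOn (hpos z h3) h2 ?_
  rw [h1, hm z h3, hm x hx]

/-- The formula involves only `m` and first derivatives of `h` on its graph, so it passes to the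
limit at the boundary. -/
theorem fderiv_of_log_add_eq (hΩ : IsOpen Ω) (ha : 0 < a)
    (h_mono : ∀ x ∈ Ω, MonotoneOn (h x) (Ioi 0))
    (h_C1 : ContDiffOn ℝ 1 (fun p : E × ℝ => h p.1 p.2) (Ω ×ˢ Ioi 0))
    (hpos : ∀ x ∈ Ω, 0 < m x) (hm : ∀ x ∈ Ω, a * Real.log (m x) + h x (m x) = c)
    (hd : DifferentiableOn ℝ m Ω) {x : E} (hx : x ∈ Ω) :
    fderiv ℝ m x = -(a * (m x)⁻¹ + fderiv ℝ (fun p : E × ℝ => h p.1 p.2) (x, m x) (0, 1))⁻¹ •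
      (fderiv ℝ (fun p : E × ℝ => h p.1 p.2) (x, m x) ∘L .inl ℝ E ℝ) := by
  have hmem : (x, m x) ∈ Ω ×ˢ Ioi (0 : ℝ) := ⟨hx, hpos x hx⟩
  have hh := (h_C1.contDiffAt ((hΩ.prod isOpen_Ioi).mem_nhds hmem)).differentiableAt (by simp)
  have hq : 0 < a * (m x)⁻¹ + fderiv ℝ (fun p : E × ℝ => h p.1 p.2) (x, m x) (0, 1) := by
    have := mul_pos ha (inv_pos.2 (hpos x hx))
    have := fderiv_snd_nonneg hΩ h_mono h_C1 hmem
    linarith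
  have hmd := (hd.differentiableAt (hΩ.mem_nhds hx)).hasFDerivAt
  have h1 := (hasFDerivAt_log_add (a := a) (h := h) (p := (x, m x)) (hpos x hx) hh).comp x
    ((hasFDerivAt_id (𝕜 := ℝ) x).prodMk hmd)
  have h2 : HasFDerivAt ((fun p : E × ℝ => a * Real.log p.2 + h p.1 p.2) ∘ fun y => (id y, m y))
      (0 : E →L[ℝ] ℝ) x := by
    refine (hasFDerivAt_const c x).congr_of_eventuallyEq ?_
    filter_upwards [hΩ.mem_nhds hx] with z hz using hm z hz
  have h3 := h1.unique h2
  ext v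
  have h4 := congrArg (fun L => L v) h3
  have h5 : fderiv ℝ (fun p : E × ℝ => h p.1 p.2) (x, m x) (v, fderiv ℝ m x v)
      = fderiv ℝ (fun p : E × ℝ => h p.1 p.2) (x, m x) (v, 0)
        + fderiv ℝ m x v * fderiv ℝ (fun p : E × ℝ => h p.1 p.2) (x, m x) (0, 1) := by
    have : (v, fderiv ℝ m x v) = (v, 0) + fderiv ℝ m x v • ((0 : E), (1 : ℝ)) := by simp
    rw [this, map_add, map_smul, smul_eq_mul]
  simp at h4
  rw [h5] at h4
  have h6 : (a * (m x)⁻¹ + fderiv ℝ (fun p : E × ℝ => h p.1 p.2) (x, m x) (0, 1)) * fderiv ℝ m x v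
      = -fderiv ℝ (fun p : E × ℝ => h p.1 p.2) (x, m x) (v, 0) := by linarith
  have h7 := inv_mul_cancel_left₀ hq.ne' (fderiv ℝ m x v)
  rw [h6] at h7
  rw [← h7]
  simp

theorem tendsto_prodMk_nhdsWithin {E : Type*} [TopologicalSpace E] {Ω : Set E} {m : E → ℝ} {p : E} {l : ℝ} (hpos : ∀ x ∈ Ω, 0 < m x)
    (hl : Tendsto m (𝓝[Ω] p) (𝓝 l)) :
    Tendsto (fun x => (x, m x)) (𝓝[Ω] p) (𝓝[Ω ×ˢ Ioi 0] (p, l)) := by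
  refine tendsto_nhdsWithin_iff.2 ⟨?_, ?_⟩
  · exact (tendsto_nhdsWithin_of_tendsto_nhds tendsto_id).prodMk_nhds hl
  · filter_upwards [self_mem_nhdsWithin] with x hx using ⟨hx, hpos x hx⟩

/-- Compactness of `[A, B]` gives a cluster value `t` of `m` at `p`, which solves the limit equation
`a log t + H t = c`, `H` being the boundary limit of `h`. For `s < t` the limit of `a log s + h x s`
is below `c`, so `s < m x` near `p`; likewise above. Hence the whole of `m` tends to `t`. -/
theorem exists_tendsto_of_log_add_eq {E : Type*} [TopologicalSpace E] {Ω : Set E}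
    {h : E → ℝ → ℝ} {m : E → ℝ} (ha : 0 < a)
    (h_mono : ∀ x ∈ Ω, MonotoneOn (h x) (Ioi 0))
    (h_lim : ∀ p ∈ closure Ω ×ˢ Ioi (0 : ℝ),
      ∃ l : ℝ, Tendsto (fun p : E × ℝ => h p.1 p.2) (𝓝[Ω ×ˢ Ioi 0] p) (𝓝 l))
    {A B : ℝ} (hA : 0 < A) (hAm : ∀ x ∈ Ω, m x ∈ Icc A B)
    (hm : ∀ x ∈ Ω, a * Real.log (m x) + h x (m x) = c) {p : E} (hp : p ∈ closure Ω) :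
    ∃ l, 0 < l ∧ Tendsto m (𝓝[Ω] p) (𝓝 l) := by
  have hpne : (𝓝[Ω] p).NeBot := mem_closure_iff_nhdsWithin_neBot.1 hp
  have hpos : ∀ x ∈ Ω, 0 < m x := fun x hx => hA.trans_le (hAm x hx).1
  have hmap : map m (𝓝[Ω] p) ≤ 𝓟 (Icc A B) := by
    rw [le_principal_iff, mem_map]
    filter_upwards [self_mem_nhdsWithin] with x hx using hAm x hx
  obtain ⟨t, ht, htc⟩ := isCompact_Icc.exists_clusterPt hmap
  have ht0 : 0 < t := hA.trans_le ht.1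
  have hvert : ∀ s : ℝ, 0 < s → Tendsto (fun x => (x, s)) (𝓝[Ω] p) (𝓝[Ω ×ˢ Ioi 0] (p, s)) := by
    intro s hs
    exact tendsto_prodMk_nhdsWithin (m := fun _ => s) (fun _ _ => hs) tendsto_const_nhds
  choose! H hH using fun (s : ℝ) (hs : 0 < s) => h_lim (p, s) ⟨hp, hs⟩
  have hHmono : MonotoneOn H (Ioi 0) := by
    intro s hs s' hs' hss
    refine le_of_tendsto_of_tendsto ((hH s hs).comp (hvert s hs)) ((hH s' hs').comp (hvert s' hs'))
      ?_
    filter_upwards [self_mem_nhdsWithin] with x hx using h_mono x hx hs hs' hss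
  have hΦ : ∀ s : ℝ, 0 < s → Tendsto (fun x => a * Real.log s + h x s) (𝓝[Ω] p)
      (𝓝 (a * Real.log s + H s)) := fun s hs =>
    tendsto_const_nhds.add ((hH s hs).comp (hvert s hs))
  have hstrict := strictMonoOn_log_add ha hHmono
  have htroot : a * Real.log t + H t = c := by
    have hne : ((𝓝[Ω] p) ⊓ comap m (𝓝 t)).NeBot := by
      have h1 : (𝓝 t ⊓ map m (𝓝[Ω] p)).NeBot := htc
      rw [inf_comm, ← Filter.push_pull] at h1
      exact h1.of_map
    have h1 : Tendsto (fun x => (x, m x)) ((𝓝[Ω] p) ⊓ comap m (𝓝 t))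
        (𝓝[Ω ×ˢ Ioi 0] (p, t)) := by
      refine tendsto_nhdsWithin_iff.2 ⟨?_, ?_⟩
      · exact (((tendsto_nhdsWithin_of_tendsto_nhds tendsto_id).mono_left inf_le_left).prodMk_nhds
          (tendsto_comap.mono_left inf_le_right))
      · filter_upwards [inf_le_left (a := 𝓝[Ω] p) self_mem_nhdsWithin] with x hx
          using ⟨hx, hpos x hx⟩
    have h2 : Tendsto (fun x => a * Real.log (m x) + h x (m x)) ((𝓝[Ω] p) ⊓ comap m (𝓝 t))
        (𝓝 (a * Real.log t + H t)) :=
      (((Real.continuousAt_log ht0.ne').tendsto.comp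
        (tendsto_comap.mono_left inf_le_right)).const_mul a).add ((hH t ht0).comp h1)
    refine tendsto_nhds_unique h2 (tendsto_const_nhds.congr' ?_)
    filter_upwards [inf_le_left (a := 𝓝[Ω] p) self_mem_nhdsWithin] with x hx using (hm x hx).symm
  refine ⟨t, ht0, tendsto_order.2 ⟨fun s hs => ?_, fun s hs => ?_⟩⟩
  · rcases le_or_gt s 0 with hs0 | hs0
    · filter_upwards [self_mem_nhdsWithin] with x hx using hs0.trans_lt (hpos x hx)
    · have := hstrict hs0 ht0 hs
      simp only [htroot] at this
      filter_upwards [self_mem_nhdsWithin, (hΦ s hs0).eventually (gt_mem_nhds this)] with x hx h1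
      rw [← hm x hx] at h1
      exact ((strictMonoOn_log_add ha (h_mono x hx)).lt_iff_lt hs0 (hpos x hx)).1 h1
  · have hs0 := ht0.trans hs
    have := hstrict ht0 hs0 hs
    simp only [htroot] at this
    filter_upwards [self_mem_nhdsWithin, (hΦ s hs0).eventually (lt_mem_nhds this)] with x hx h1
    rw [← hm x hx] at h1
    exact ((strictMonoOn_log_add ha (h_mono x hx)).lt_iff_lt (hpos x hx) hs0).1 h1

theorem isC1UpTo_of_log_add_eq (hΩ : IsOpen Ω) (ha : 0 < a)
    (h_mono : ∀ x ∈ Ω, MonotoneOn (h x) (Ioi 0))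
    (h_C1 : IsC1UpTo (Ω ×ˢ Ioi 0) (closure Ω ×ˢ Ioi 0) (fun p : E × ℝ => h p.1 p.2))
    {A B : ℝ} (hA : 0 < A) (hAm : ∀ x ∈ Ω, m x ∈ Icc A B)
    (hm : ∀ x ∈ Ω, a * Real.log (m x) + h x (m x) = c) (hmC1 : ContDiffOn ℝ 1 m Ω) :
    IsC1UpTo Ω (closure Ω) m := by
  refine ⟨hmC1, fun p hp => ?_⟩
  have hpne : (𝓝[Ω] p).NeBot := mem_closure_iff_nhdsWithin_neBot.1 hp
  have hpos : ∀ x ∈ Ω, 0 < m x := fun x hx => hA.trans_le (hAm x hx).1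
  obtain ⟨l, hl, hml⟩ := exists_tendsto_of_log_add_eq ha h_mono (fun p hp => (h_C1.2 p hp).1)
    hA hAm hm hp
  obtain ⟨L, hL⟩ := (h_C1.2 (p, l) ⟨hp, hl⟩).2
  have h1 := hL.comp (tendsto_prodMk_nhdsWithin hpos hml)
  have h2 : Tendsto (fun x => fderiv ℝ (fun p : E × ℝ => h p.1 p.2) (x, m x) (0, 1)) (𝓝[Ω] p)
      (𝓝 (L (0, 1))) := by
    have : Continuous fun T : E × ℝ →L[ℝ] ℝ => T (0, 1) := by fun_prop
    exact (this.tendsto L).comp h1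
  have h3 : 0 ≤ L (0, 1) := by
    refine ge_of_tendsto h2 ?_
    filter_upwards [self_mem_nhdsWithin] with x hx
    exact fderiv_snd_nonneg hΩ h_mono h_C1.1 (p := (x, m x)) ⟨hx, hpos x hx⟩
  have h4 : a * l⁻¹ + L (0, 1) ≠ 0 := by
    have := mul_pos ha (inv_pos.2 hl)
    linarith
  have h5 : Tendsto (fun x => fderiv ℝ (fun p : E × ℝ => h p.1 p.2) (x, m x) ∘L .inl ℝ E ℝ)
      (𝓝[Ω] p) (𝓝 (L ∘L .inl ℝ E ℝ)) := by
    have : Continuous fun T : E × ℝ →L[ℝ] ℝ => T ∘L .inl ℝ E ℝ := by fun_prop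
    exact (this.tendsto L).comp h1
  refine ⟨⟨l, hml⟩, _, ((((hml.inv₀ hl.ne').const_mul a).add h2).inv₀ h4).neg.smul h5 |>.congr' ?_⟩
  filter_upwards [self_mem_nhdsWithin] with x hx
  exact (fderiv_of_log_add_eq hΩ ha h_mono h_C1.1 hpos hm (hmC1.differentiableOn (by simp)) hx).symm

end implicit

/-! ### The boundary value problem and constancy of the potential. -/

section

variable {d : ℕ} {Ω : Set (EuclideanSpace ℝ (Fin d))} {h : EuclideanSpace ℝ (Fin d) → ℝ → ℝ}
  {m : EuclideanSpace ℝ (Fin d) → ℝ} {a c : ℝ}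

theorem contDiffOn_comp_graph (h_C2 : ContDiffOn ℝ 2
      (fun p : EuclideanSpace ℝ (Fin d) × ℝ => h p.1 p.2) (Ω ×ˢ Ioi 0))
    (hpos : ∀ x ∈ Ω, 0 < m x) (hm : ContDiffOn ℝ 2 m Ω) :
    ContDiffOn ℝ 2 (fun x => h x (m x)) Ω :=
  h_C2.comp (contDiffOn_id.prodMk hm) fun x hx => ⟨hx, hpos x hx⟩

theorem gradient_log_add {x : EuclideanSpace ℝ (Fin d)} (hpos : 0 < m x)
    (hm : DifferentiableAt ℝ m x) (hh : DifferentiableAt ℝ (fun y => h y (m y)) x) :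
    m x • gradient (fun y => a * Real.log (m y) + h y (m y)) x
      = a • gradient m x + brsDrift h m x := by
  have h1 : HasGradientAt (fun y => a * Real.log (m y) + h y (m y))
      ((a * (m x)⁻¹) • gradient m x + gradient (fun y => h y (m y)) x) x := by
    rw [hasGradientAt_iff_hasFDerivAt]
    have e1 := ((hm.hasFDerivAt.log hpos.ne').const_mul a).add hh.hasFDerivAt
    refine e1.congr_fderiv ?_
    rw [smul_smul, map_add, map_smul, toDual_gradient, toDual_gradient]
  rw [h1.gradient, smul_add, smul_smul, brsDrift]
  congr 2
  field_simp

/-- A classical solution makes the chemical potential `(σ² / 2) log m + h(x, m)` constant. -/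
theorem IsStationaryBRS.exists_log_add_eq {σ : ℝ} {α : NNReal} (hσ : 0 < σ)
    (hΩ : IsOpen Ω) (hbdd : Bornology.IsBounded Ω) (hconn : IsConnected Ω)
    (hbdry : HasC2HolderBoundary α Ω) (h_mono : ∀ x ∈ Ω, MonotoneOn (h x) (Ioi 0))
    (h_bound : ∃ b : ℝ, ∀ x ∈ Ω, h x 1 ≤ b)
    (h_C2 : ContDiffOn ℝ 2 (fun p : EuclideanSpace ℝ (Fin d) × ℝ => h p.1 p.2) (Ω ×ˢ Ioi 0))
    (h_C1 : IsC1UpTo (Ω ×ˢ Ioi 0) (closure Ω ×ˢ Ioi 0)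
      (fun p : EuclideanSpace ℝ (Fin d) × ℝ => h p.1 p.2))
    (hm : IsStationaryBRS σ Ω h m) :
    ∃ c, ∀ x ∈ Ω, σ ^ 2 / 2 * Real.log (m x) + h x (m x) = c := by
  have ha : 0 < σ ^ 2 / 2 := by positivity
  have hH := contDiffOn_comp_graph h_C2 hm.pos hm.contDiffOn
  have hmat : ∀ x ∈ Ω, ContDiffAt ℝ 2 m x := fun x hx =>
    hm.contDiffOn.contDiffAt (hΩ.mem_nhds hx)
  have hHat : ∀ x ∈ Ω, ContDiffAt ℝ 2 (fun y => h y (m y)) x := fun x hx =>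
    hH.contDiffAt (hΩ.mem_nhds hx)
  have hu : ContDiffOn ℝ 2 (fun y => σ ^ 2 / 2 * Real.log (m y) + h y (m y)) Ω :=
    (contDiffOn_const.mul (hm.contDiffOn.log fun x hx => (hm.pos x hx).ne')).add hH
  have hgrad : ∀ x ∈ Ω, m x • gradient (fun y => σ ^ 2 / 2 * Real.log (m y) + h y (m y)) x
      = (σ ^ 2 / 2) • gradient m x + brsDrift h m x := fun x hx =>
    gradient_log_add (hm.pos x hx) ((hmat x hx).differentiableAt (by simp))
      ((hHat x hx).differentiableAt (by simp))
  refine exists_eqOn_const_of_noFlux hΩ hbdd hconn hbdry hm.pos hm.isC1UpTo hu ?_ ?_ ?_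
  · intro x hx
    have huat := hu.contDiffAt (hΩ.mem_nhds hx)
    have hmd : DifferentiableAt ℝ m x := (hmat x hx).differentiableAt (by simp)
    have e1 := divergence_smul hmd (differentiableAt_gradient huat)
    have e2 : divergence (fun y => m y •
        gradient (fun y => σ ^ 2 / 2 * Real.log (m y) + h y (m y)) y) x
        = divergence (fun y => (σ ^ 2 / 2) • gradient m y + brsDrift h m y) x := by
      refine divergence_congr ?_
      filter_upwards [hΩ.mem_nhds hx] with y hy using hgrad y hy
    have hgm := differentiableAt_gradient (hmat x hx)
    have e3 : DifferentiableAt ℝ (brsDrift h m) x :=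
      hmd.smul (differentiableAt_gradient (hHat x hx))
    rw [divergence_add (hgm.fun_const_smul _) e3, divergence_const_smul _ hgm,
      divergence_gradient (hmat x hx)] at e2
    rw [e2, divergence_gradient huat] at e1
    have := hm.pde x hx
    linarith
  · intro x hx ν hν
    have := (hm.noFlux x hx ν hν).neg
    rw [neg_zero] at this
    refine this.congr' ?_
    filter_upwards [self_mem_nhdsWithin] with y hy
    have e1 := congrArg (fun v => inner ℝ v ν) (hgrad y hy)
    simp only [real_inner_smul_left, inner_add_left] at e1
    linarith
  · intro p hp
    have hpne : (𝓝[Ω] p).NeBot := mem_closure_iff_nhdsWithin_neBot.1 hp.1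
    obtain ⟨l, hl⟩ := (hm.isC1UpTo.2 p hp.1).1
    have hl0 : 0 ≤ l := by
      refine ge_of_tendsto hl ?_
      filter_upwards [self_mem_nhdsWithin] with x hx using (hm.pos x hx).le
    rcases hl0.eq_or_lt with rfl | hlpos
    -- Here `log m` tends to `-∞` while `h x (m x) ≤ h x 1 ≤ b` as soon as `m x < 1`.
    · right
      obtain ⟨b, hb⟩ := h_bound
      have h1 : Tendsto m (𝓝[Ω] p) (𝓝[≠] 0) := tendsto_nhdsWithin_iff.2 ⟨hl, by
        filter_upwards [self_mem_nhdsWithin] with x hx using (hm.pos x hx).ne'⟩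
      have h2 := (Real.tendsto_log_nhdsNE_zero.comp h1).const_mul_atBot ha
      refine tendsto_atBot_add_right_of_ge' _ b h2 ?_
      filter_upwards [self_mem_nhdsWithin, hl.eventually (gt_mem_nhds one_pos)] with x hx hx1
      exact (h_mono x hx (hm.pos x hx) (mem_Ioi.2 one_pos) hx1.le).trans (hb x hx)
    · left
      obtain ⟨L, hL⟩ := (h_C1.2 (p, l) ⟨hp.1, hlpos⟩).1
      exact ⟨⟨l, hlpos, hl⟩, _, (((Real.continuousAt_log hlpos.ne').tendsto.comp hl).const_mul
        _).add (hL.comp (tendsto_prodMk_nhdsWithin hm.pos hl))⟩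

/-- Conversely, constancy of the chemical potential gives a classical solution. -/
theorem isStationaryBRS_of_log_add_eq {σ : ℝ} (hσ : 0 < σ) (hΩ : IsOpen Ω)
    (h_mono : ∀ x ∈ Ω, MonotoneOn (h x) (Ioi 0))
    (h_C2 : ContDiffOn ℝ 2 (fun p : EuclideanSpace ℝ (Fin d) × ℝ => h p.1 p.2) (Ω ×ˢ Ioi 0))
    (h_C1 : IsC1UpTo (Ω ×ˢ Ioi 0) (closure Ω ×ˢ Ioi 0)
      (fun p : EuclideanSpace ℝ (Fin d) × ℝ => h p.1 p.2))
    {A B : ℝ} (hA : 0 < A) (hAm : ∀ x ∈ Ω, m x ∈ Icc A B)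
    (hm : ∀ x ∈ Ω, σ ^ 2 / 2 * Real.log (m x) + h x (m x) = c) (hint : ∫ x in Ω, m x = 1) :
    IsStationaryBRS σ Ω h m := by
  have ha : 0 < σ ^ 2 / 2 := by positivity
  have hpos : ∀ x ∈ Ω, 0 < m x := fun x hx => hA.trans_le (hAm x hx).1
  have hC2 := contDiffOn_of_log_add_eq hΩ ha h_mono h_C2 hpos hm
  have hmat : ∀ x ∈ Ω, ContDiffAt ℝ 2 m x := fun x hx => hC2.contDiffAt (hΩ.mem_nhds hx)
  -- The potential has zero gradient, so diffusion and drift cancel pointwise in `Ω`; the equation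
  -- and the boundary condition both follow.
  have hdrift : ∀ x ∈ Ω, brsDrift h m x = (-(σ ^ 2 / 2)) • gradient m x := by
    intro x hx
    have hH := (contDiffOn_comp_graph h_C2 hpos hC2).contDiffAt (hΩ.mem_nhds hx)
    have e1 := gradient_log_add (a := σ ^ 2 / 2) (hpos x hx)
      ((hmat x hx).differentiableAt (by simp)) (hH.differentiableAt (by simp))
    have e2 : (fun y => σ ^ 2 / 2 * Real.log (m y) + h y (m y)) =ᶠ[𝓝 x] fun _ => c := by
      filter_upwards [hΩ.mem_nhds hx] with y hy using hm y hy
    rw [e2.gradient_eq, gradient_fun_const, smul_zero] at e1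
    rw [neg_smul]
    exact eq_neg_of_add_eq_zero_right e1.symm
  refine ⟨hpos, hC2, isC1UpTo_of_log_add_eq hΩ ha h_mono h_C1 hA hAm hm (hC2.of_le (by norm_num)),
    fun x hx => ?_, fun x hx ν hν => ?_, hint⟩
  · have e1 : brsDrift h m =ᶠ[𝓝 x] fun y => (-(σ ^ 2 / 2)) • gradient m y := by
      filter_upwards [hΩ.mem_nhds hx] with y hy using hdrift y hy
    rw [divergence_congr e1, divergence_const_smul _ (differentiableAt_gradient (hmat x hx)),
      divergence_gradient (hmat x hx)]
    ring
  · refine tendsto_const_nhds.congr' ?_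
    filter_upwards [self_mem_nhdsWithin] with y hy
    rw [hdrift y hy, real_inner_smul_left]
    ring

end

/-! ### Normalising the mass. -/

section mass

variable {X : Type*} [MeasurableSpace X] {μ : Measure X} {Ω : Set X} {h : X → ℝ → ℝ} {a : ℝ}
  {S : ℝ → X → ℝ}

theorem setIntegral_lt_of_lt (hΩm : MeasurableSet Ω) (hμ : μ Ω ≠ 0) {f g : X → ℝ}
    (hf : IntegrableOn f Ω μ) (hg : IntegrableOn g Ω μ) (hfg : ∀ x ∈ Ω, f x < g x) :
    ∫ x in Ω, f x ∂μ < ∫ x in Ω, g x ∂μ := by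
  rw [← sub_pos, ← integral_sub hg hf]
  have hnn : 0 ≤ᵐ[μ.restrict Ω] fun x => g x - f x :=
    (ae_restrict_iff' hΩm).2 (Eventually.of_forall fun x hx => (sub_pos.2 (hfg x hx)).le)
  rw [setIntegral_pos_iff_support_of_nonneg_ae hnn (hg.sub hf)]
  have : Function.support (fun x => g x - f x) ∩ Ω = Ω :=
    inter_eq_right.2 fun x hx => (sub_pos.2 (hfg x hx)).ne'
  rw [this]
  exact pos_iff_ne_zero.2 hμ

/-- The mass of the level `c` solution of `a log s + h(x, s) = c` takes the value `1`. -/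
theorem exists_setIntegral_eq_one (hΩm : MeasurableSet Ω) (hμ : μ Ω ≠ 0) (hμ' : μ Ω ≠ ⊤)
    (ha : 0 < a) (h_mono : ∀ x ∈ Ω, MonotoneOn (h x) (Ioi 0)) {g : ℝ → ℝ}
    (hg : ∀ x ∈ Ω, ∀ s ∈ Ioi (0 : ℝ), |h x s| ≤ g s)
    (hSpos : ∀ c, ∀ x ∈ Ω, 0 < S c x)
    (hS : ∀ c, ∀ x ∈ Ω, a * Real.log (S c x) + h x (S c x) = c)
    (hint : ∀ c, IntegrableOn (S c) Ω μ) : ∃ c, ∫ x in Ω, S c x ∂μ = 1 := by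
  have hV : 0 < μ.real Ω := ENNReal.toReal_pos hμ hμ'
  set K := (μ.real Ω)⁻¹ with hK
  have hKpos : 0 < K := inv_pos.2 hV
  have hconst : ∫ _ in Ω, K ∂μ = 1 := by
    rw [setIntegral_const, smul_eq_mul, hK, mul_inv_cancel₀ hV.ne']
  have hKint : IntegrableOn (fun _ => K) Ω μ := integrableOn_const hμ'
  have hlt : ∀ {c : ℝ}, ∀ x ∈ Ω, ∀ s, 0 < s →
      ((S c x < s ↔ c < a * Real.log s + h x s) ∧ (s < S c x ↔ a * Real.log s + h x s < c)) := by
    intro c x hx s hs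
    have hmono := strictMonoOn_log_add ha (h_mono x hx)
    rw [← hmono.lt_iff_lt (hSpos c x hx) hs, ← hmono.lt_iff_lt hs (hSpos c x hx)]
    simp only [hS c x hx, and_self]
  have hmonoS : ∀ x ∈ Ω, ∀ c c', c < c' → S c x < S c' x := by
    intro x hx c c' hcc
    rw [(hlt x hx _ (hSpos c' x hx)).1, hS c' x hx]
    exact hcc
  have hScont : ∀ x ∈ Ω, Continuous fun c => S c x := by
    intro x hx
    have h1 : LipschitzWith (Real.toNNReal a⁻¹) fun c => Real.log (S c x) := by
      refine LipschitzWith.of_dist_le_mul fun c c' => ?_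
      rw [Real.coe_toNNReal _ (inv_pos.2 ha).le, Real.dist_eq, Real.dist_eq, inv_mul_eq_div,
        le_div_iff₀ ha, mul_comm]
      exact abs_log_sub_log_le ha (h_mono x hx) (hSpos c' x hx) (hSpos c x hx) (hS c' x hx)
        (hS c x hx)
    refine (Real.continuous_exp.comp h1.continuous).congr fun c => ?_
    exact Real.exp_log (hSpos c x hx)
  have hcont : Continuous fun c => ∫ x in Ω, S c x ∂μ := by
    refine continuous_iff_continuousAt.2 fun c => ?_
    -- Solutions increase with the level, so the one at `c + 1` dominates those at nearby levels.
    refine continuousAt_of_dominated (bound := S (c + 1))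
      (Eventually.of_forall fun c' => (hint c').aestronglyMeasurable) ?_ (hint (c + 1)) ?_
    · filter_upwards [gt_mem_nhds (lt_add_one c)] with c' hc'
      refine (ae_restrict_iff' hΩm).2 (Eventually.of_forall fun x hx => ?_)
      rw [Real.norm_of_nonneg (hSpos c' x hx).le]
      exact (hmonoS x hx _ _ hc').le
    · exact (ae_restrict_iff' hΩm).2
        (Eventually.of_forall fun x hx => (hScont x hx).continuousAt)
  -- `K = 1 / μ(Ω)` is the constant density of mass `1`. Below the level `a log K - g K` the
  -- solution lies under `K` everywhere, above `a log K + g K` over it.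
  refine mem_range_of_exists_le_of_exists_ge hcont ⟨a * Real.log K - g K - 1, ?_⟩
    ⟨a * Real.log K + g K + 1, ?_⟩
  · rw [← hconst]
    refine setIntegral_mono_on (hint _) hKint hΩm fun x hx => ?_
    refine ((hlt x hx K hKpos).1.2 ?_).le
    linarith [(abs_le.1 (hg x hx K hKpos)).1]
  · rw [← hconst]
    refine setIntegral_mono_on hKint (hint _) hΩm fun x hx => ?_
    refine ((hlt x hx K hKpos).2.2 ?_).le
    linarith [(abs_le.1 (hg x hx K hKpos)).2]

end mass

/-! ### Uniform bounds and conclusion. -/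

/-- Only the size of `k 1` enters, so the bounds are uniform in `x`: if `s ≤ 1` then `k s ≤ b`,
hence `a log s ≥ c - b`, and symmetrically for `s ≥ 1`. -/
theorem mem_Icc_of_log_add_eq {a c b s : ℝ} {k : ℝ → ℝ} (ha : 0 < a)
    (hk : MonotoneOn k (Ioi 0)) (hb : |k 1| ≤ b) (hs : 0 < s) (hsc : a * Real.log s + k s = c) :
    s ∈ Icc (min 1 (Real.exp ((c - b) / a))) (max 1 (Real.exp ((c + b) / a))) := by
  have hb' := abs_le.1 hb
  rcases le_total s 1 with h1 | h1
  · refine ⟨(min_le_right _ _).trans ?_, h1.trans (le_max_left _ _)⟩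
    have := hk hs (mem_Ioi.2 one_pos) h1
    rw [← Real.le_log_iff_exp_le hs, div_le_iff₀ ha]
    linarith
  · refine ⟨(min_le_left _ _).trans h1, le_max_of_le_right ?_⟩
    have := hk (mem_Ioi.2 one_pos) hs h1
    rw [← Real.log_le_iff_le_exp hs, le_div_iff₀ ha]
    linarith

theorem mainTheorem1 {d : ℕ} (hd : 1 ≤ d) {σ : ℝ} (hσ : 0 < σ)
    {α : NNReal} (hα0 : 0 < α) (hα1 : α < 1)
    {Ω : Set (EuclideanSpace ℝ (Fin d))}
    (hΩ_open : IsOpen Ω) (hΩ_bdd : Bornology.IsBounded Ω) (hΩ_conn : IsConnected Ω)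
    (hΩ_bdry : HasC2HolderBoundary α Ω)
    {h : EuclideanSpace ℝ (Fin d) → ℝ → ℝ}
    (h_mono : ∀ x ∈ Ω, MonotoneOn (h x) (Ioi 0))
    (h_bound : ∃ g : ℝ → ℝ, ContinuousOn g (Ioi 0) ∧ (∀ s ∈ Ioi (0 : ℝ), 0 ≤ g s) ∧
      ∀ x ∈ Ω, ∀ s ∈ Ioi (0 : ℝ), |h x s| ≤ g s)
    (h_C2 : ContDiffOn ℝ 2 (fun p : EuclideanSpace ℝ (Fin d) × ℝ => h p.1 p.2) (Ω ×ˢ Ioi 0))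
    (h_C1 : IsC1UpTo (Ω ×ˢ Ioi 0) (closure Ω ×ˢ Ioi 0)
      (fun p : EuclideanSpace ℝ (Fin d) × ℝ => h p.1 p.2))
    (h_grad_bound : ∃ f : ℝ → ℝ, ContinuousOn f (Ioi 0) ∧ (∀ s ∈ Ioi (0 : ℝ), 0 ≤ f s) ∧
      ∀ x ∈ Ω, ∀ s ∈ Ioi (0 : ℝ), ‖gradient (fun y => h y s) x‖ ≤ f s) :
    ∃ (m : EuclideanSpace ℝ (Fin d) → ℝ) (Z : ℝ),
      IsStationaryBRS σ Ω h m ∧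
      (∀ m' : EuclideanSpace ℝ (Fin d) → ℝ, IsStationaryBRS σ Ω h m' → EqOn m' m Ω) ∧
      0 < Z ∧ (∀ x ∈ Ω, m x = Z⁻¹ * Real.exp (-2 * h x (m x) / σ ^ 2)) ∧
      (∀ (m' : EuclideanSpace ℝ (Fin d) → ℝ) (Z' : ℝ), 0 < Z' → (∀ x ∈ Ω, 0 < m' x) →
        (∀ x ∈ Ω, m' x = Z'⁻¹ * Real.exp (-2 * h x (m' x) / σ ^ 2)) →
        ∫ x in Ω, m' x = 1 → Z' = Z ∧ EqOn m' m Ω) := by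
  obtain ⟨g, -, -, hg⟩ := h_bound
  set a : ℝ := σ ^ 2 / 2 with ha_def
  have ha : 0 < a := by positivity
  have hh_cont : ∀ x ∈ Ω, ContinuousOn (h x) (Ioi 0) := by
    intro x hx
    exact h_C2.continuousOn.comp (f := fun s : ℝ => (x, s)) (by fun_prop) fun s hs => ⟨hx, hs⟩
  have hμ : volume Ω ≠ 0 := (hΩ_open.measure_pos volume hΩ_conn.nonempty).ne'
  have hμ' : volume Ω ≠ ⊤ := hΩ_bdd.measure_lt_top.ne
  have hmeas := hΩ_open.measurableSet
  choose! S hSpos hS using fun (c : ℝ) (x : EuclideanSpace ℝ (Fin d)) (hx : x ∈ Ω) =>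
    exists_log_add_eq ha (h_mono x hx) (hh_cont x hx) c
  have hSbd : ∀ c, ∀ x ∈ Ω, S c x ∈ Icc _ _ := fun c x hx =>
    mem_Icc_of_log_add_eq ha (h_mono x hx) (hg x hx 1 (mem_Ioi.2 one_pos)) (hSpos c x hx)
      (hS c x hx)
  have hlow : ∀ c, 0 < min 1 (Real.exp ((c - g 1) / a)) := fun c =>
    lt_min one_pos (Real.exp_pos _)
  have hint : ∀ c, IntegrableOn (S c) Ω := by
    intro c
    have hcont := (contDiffOn_of_log_add_eq hΩ_open ha h_mono h_C2 (hSpos c) (hS c)).continuousOn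
    refine IntegrableOn.of_bound hμ'.lt_top (hcont.aestronglyMeasurable hmeas)
      (max 1 (Real.exp ((c + g 1) / a))) ?_
    refine (ae_restrict_iff' hmeas).2 (Eventually.of_forall fun x hx => ?_)
    rw [Real.norm_of_nonneg (hSpos c x hx).le]
    exact (hSbd c x hx).2
  obtain ⟨c, hc⟩ := exists_setIntegral_eq_one hmeas hμ hμ' ha h_mono hg hSpos hS hint
  have huniq : ∀ (m' : EuclideanSpace ℝ (Fin d) → ℝ) (c' : ℝ), (∀ x ∈ Ω, 0 < m' x) →
      (∀ x ∈ Ω, a * Real.log (m' x) + h x (m' x) = c') → ∫ x in Ω, m' x = 1 →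
      c' = c ∧ EqOn m' (S c) Ω := by
    intro m' c' hpos' hm' hint'
    have heq : EqOn m' (S c') Ω := fun x hx =>
      (strictMonoOn_log_add ha (h_mono x hx)).injOn (hpos' x hx) (hSpos c' x hx)
        ((hm' x hx).trans (hS c' x hx).symm)
    have hc' : ∫ x in Ω, S c' x = 1 := by rw [← setIntegral_congr_fun hmeas heq, hint']
    -- Strict monotonicity of the mass identifies the level.
    have hlt : ∀ c₁ c₂, c₁ < c₂ → ∫ x in Ω, S c₁ x < ∫ x in Ω, S c₂ x := by
      intro c₁ c₂ hcc
      refine setIntegral_lt_of_lt hmeas hμ (hint _) (hint _) fun x hx => ?_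
      rw [← (strictMonoOn_log_add ha (h_mono x hx)).lt_iff_lt (hSpos _ x hx) (hSpos _ x hx)]
      simpa only [hS _ x hx] using hcc
    have : c' = c := by
      rcases lt_trichotomy c' c with hlt' | heq' | hgt
      · have := hlt _ _ hlt'
        linarith
      · exact heq'
      · have := hlt _ _ hgt
        linarith
    exact ⟨this, this ▸ heq⟩
  have hZc : -(a * Real.log (Real.exp (-c / a))) = c := by
    rw [Real.log_exp]
    field_simp
  refine ⟨S c, Real.exp (-c / a), isStationaryBRS_of_log_add_eq hσ hΩ_open h_mono h_C2 h_C1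
    (hlow c) (hSbd c) (hS c) hc, fun m' hm' => ?_, Real.exp_pos _, fun x hx => ?_,
    fun m' Z' hZ' hpos' hm' hint' => ?_⟩
  · obtain ⟨c', hc'⟩ := hm'.exists_log_add_eq hσ hΩ_open hΩ_bdd hΩ_conn hΩ_bdry h_mono
      ⟨g 1, fun x hx => (abs_le.1 (hg x hx 1 (mem_Ioi.2 one_pos))).2⟩ h_C2 h_C1
    exact (huniq m' c' hm'.pos hc' hm'.integral_eq_one).2
  · rw [eq_inv_mul_exp_iff hσ (hSpos c x hx) (Real.exp_pos _), hS c x hx, hZc]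
  · obtain ⟨h1, h2⟩ := huniq m' (-(a * Real.log Z')) hpos' (fun x hx =>
      (eq_inv_mul_exp_iff hσ (hpos' x hx) hZ').1 (hm' x hx)) hint'
    refine ⟨?_, h2⟩
    rw [← Real.exp_log hZ']
    congr 1
    rw [← h1]
    field_simp
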